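/- Let $\Sigma$ be a finite alphabet containing two distinct symbols $\mathbf 0,\mathbf 1$, let $\circ\notin\Sigma$ be a symbol for the empty cell, put $\Sigma_\circ:=\Sigma\cup\{\circ\}$, and fix a total ordering of $\Sigma_\circ$. A *tape content* is a partial class function $x$ from $\mathrm{Ord}$ to $\Sigma$ (we write $x(\eta)=\circ$ if $x(\eta)$ is undefined), and $\Sigma^{<\mathrm{Ord}}$ is the class of tape contents whose domain is an ordinal. A *transfinite program* is a partial function $p\colon \mathrm{Ord}\times\Sigma_\circ\dashrightarrow\mathrm{Ord}\times\Sigma_\circ\times\{\text{left},\text{stay},\text{right}\}$ whose domain is a set. The *computation* of $p$ on a tape content $x$ is the sequence of snapshots $(x_\gamma,\alpha_\gamma,\beta_\gamma)$ (tape content, state, head position), $\gamma\in\mathrm{Ord}$, given as follows. - $(x_0,\alpha_0,\beta_0)=(x,0,0)$. - If $p(\alpha_\gamma,x_\gamma(\beta_\gamma))$ is undefined, the snapshot at $\gamma+1$ is the snapshot at $\gamma$. If $p(\alpha_\gamma,x_\gamma(\beta_\gamma))=(\delta,\sigma,\mathbf m)$, then $x_{\gamma+1}$ is $x_\gamma$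 with the content of cell $\beta_\gamma$ replaced by $\sigma$, $\alpha_{\gamma+1}=\delta$, and $\beta_{\gamma+1}$ is $\beta_\gamma+1$ for "right", $\beta_\gamma$ for "stay", and for "left" it is the predecessor of $\beta_\gamma$ if $\beta_\gamma$ is a successor and $0$ otherwise. - If $\lambda$ is a limit, then $x_\lambda(\eta)=\liminf_{\xi<\lambda}x_\xi(\eta)$ for every $\eta$, $\alpha_\lambda=\liminf_{\xi<\lambda}\alpha_\xi$, and $\beta_\lambda=\liminf_{\xi\in I}\beta_\xi:=\sup_{\xi\in I}\min_{\zeta\in I,\,\zeta\ge\xi}\beta_\zeta$, where $I=\{\xi<\lambda : \alpha_\xi=\alpha_\lambda\}$ (with $\sup\varnothing=0$). The computation *halts* if $\alpha_\gamma=1$ for some $\gamma$; its *output*, denoted $p(x)$, is then $x_\gamma$ for the least such $\gamma$. If it does not halt, $p(x)$ is undefined. A non-empty class $A\subseteq\Sigma^{<\mathrm{Ord}}$ is *symmetrically semidecidable* if there is a transfinite program $p$ such that, for every $w\in\Sigma^{<\mathrm{Ord}}$, $p(w)$ is the word of length one with entry $\mathbf 0$ if $w\in A$, and $p(w)$ is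 undefined if $w\notin A$. It is *symmetrically computably enumerable* if there is a transfinite program $p$ such that $A$ is the class of all (defined) outputs $p(v)$ for $v\in\Sigma^{\mathrm O}$, where $\Sigma^{\mathrm O}$ is the class of tape contents whose domain is a singleton $\{\alpha\}$, $\alpha\in\mathrm{Ord}$, with value $\mathbf 0$ there. **Proposition.** The following are equivalent: 1. (The symmetry condition $\mathsf{SC}$.) The class $\Sigma^{<\mathrm{Ord}}$ is symmetrically computably enumerable. 2. Every non-empty symmetrically semidecidable class $A\subseteq\Sigma^{<\mathrm{Ord}}$ is symmetrically computably enumerable. -/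

import Mathlib

universe u v

/-! Sets and classes: `Ordinal.{u}` is the class of all ordinals, "set-sized" means `Small.{u}`, and
classes of ordinals, of tape contents, etc. are arbitrary `Set`s of them. -/

noncomputable section

namespace SymMachine

/-- The motion tokens. -/
inductive Motion
  | left
  | stay
  | right

/-- Tape contents: partial functions from the ordinals to the alphabet `S`. The value `none` is the
symbol for an empty cell, so `Option S` is the alphabet extended by the blank. -/
abbrev Tape (S : Type v) := Ordinal.{u} → Option S

/-- A snapshot: tape content, state, position of the head. -/
structure Snapshot (S : Type v) where
  tape : Tape.{u} S
  state : Ordinal.{u}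
  head : Ordinal.{u}

/-- Transfinite programs: partial functions assigning to a state and a read symbol a new state, a
symbol to write and a motion token; the domain is a set. -/
structure Program (S : Type v) where
  toFun : Ordinal.{u} × Option S → Option (Ordinal.{u} × Option S × Motion)
  small_dom : Small.{u} {q : Ordinal.{u} × Option S // (toFun q).isSome}

/-- Head movement. Moving left from a successor is taking the predecessor; moving left from `0` or
from a limit leads to `0`. -/
def move (m : Motion) (β : Ordinal.{u}) : Ordinal.{u} :=
  match m with
  | .left => Ordinal.limitRecOn β 0 (fun γ _ => γ) (fun _ _ _ => 0)
  | .stay => β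
  | .right => β + 1

/-- The inferior limit `sup_{ξ ∈ I} min_{ζ ∈ I, ξ ≤ ζ} f ζ` of the ordinals `f ξ` with `ξ ∈ I`, where
`I` is a class of indices below `l`. -/
def ordLiminf {l : Ordinal.{u}} (I : Set (Set.Iio l)) (f : Set.Iio l → Ordinal.{u}) : Ordinal.{u} :=
  sSup {a | ∃ ξ ∈ I, ∀ ζ ∈ I, ξ ≤ ζ → a ≤ f ζ}

open Classical in
/-- The inferior limit of a sequence of symbols: the greatest symbol that is eventually a lower
bound (such a symbol exists if `0 < l`). -/
def symLiminf {S : Type v} [Fintype S] [LinearOrder (Option S)] {l : Ordinal.{u}}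
    (f : Set.Iio l → Option S) : Option S :=
  let B : Finset (Option S) := Finset.univ.filter fun a => ∃ ξ, ∀ ζ, ξ ≤ ζ → a ≤ f ζ
  if h : B.Nonempty then B.max' h else none

open Classical in
/-- The transition rule for sequences of successor length, applied to the last snapshot. -/
def step {S : Type v} (p : Program.{u} S) (s : Snapshot.{u} S) : Snapshot.{u} S :=
  match p.toFun (s.state, s.tape s.head) with
  | none => s
  | some (δ, σ, m) => ⟨Function.update s.tape s.head σ, δ, move m s.head⟩

/-- The transfinite transition rule for sequences of limit length `l`: inferior limits of the cell
contents and of the states, and of those head positions which occurred at the new state. -/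
def limitSnapshot {S : Type v} [Fintype S] [LinearOrder (Option S)] {l : Ordinal.{u}}
    (s : Set.Iio l → Snapshot.{u} S) : Snapshot.{u} S where
  tape η := symLiminf fun ξ => (s ξ).tape η
  state := ordLiminf Set.univ fun ξ => (s ξ).state
  head := ordLiminf {ξ | (s ξ).state = ordLiminf Set.univ fun ζ => (s ζ).state}
    fun ξ => (s ξ).head

/-- The computation of the program `p` with initial snapshot `s`. -/
def computation {S : Type v} [Fintype S] [LinearOrder (Option S)] (p : Program.{u} S)
    (s : Snapshot.{u} S) (γ : Ordinal.{u}) : Snapshot.{u} S :=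
  Ordinal.limitRecOn γ s (fun _ t => step p t)
    (fun l _ t => limitSnapshot fun ξ : Set.Iio l => t ξ.1 ξ.2)

/-- The times at which the computation of `p` on the tape content `x`, started in state `0` at cell
`0`, is in the halt state `1`. -/
def haltTimes {S : Type v} [Fintype S] [LinearOrder (Option S)] (p : Program.{u} S)
    (x : Tape.{u} S) : Set Ordinal.{u} :=
  {τ | (computation p ⟨x, 0, 0⟩ τ).state = 1}

/-- The transfinite interpretation of `p`: the partial function that sends `x` to the tape content
at the halting time (the least time at which the state is `1`), if there is one. -/
def interp {S : Type v} [Fintype S] [LinearOrder (Option S)] (p : Program.{u} S) :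
    Tape.{u} S →. Tape.{u} S :=
  fun x => ⟨(haltTimes p x).Nonempty, fun _ => (computation p ⟨x, 0, 0⟩ (sInf (haltTimes p x))).tape⟩

/-- The class of words: tape contents whose domain is an ordinal. -/
abbrev Word (S : Type v) := {x : Tape.{u} S // ∃ ξ : Ordinal.{u}, ∀ η, (x η).isSome ↔ η < ξ}

/-- The tape content with the single symbol `o`, in cell `α`; it represents the ordinal `α`. -/
def ordTape {S : Type v} (o : S) (α : Ordinal.{u}) : Tape.{u} S :=
  open Classical in fun η => if η = α then some o else none

/-- The word of length one consisting of the symbol `o`. -/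
def singleWord {S : Type v} (o : S) : Word.{u} S :=
  ⟨ordTape o 0, 1, fun η => by simp [ordTape]⟩

/-- A partial function from words to words is symmetrically computable if it is the restriction to
words of the interpretation of a transfinite program. -/
def IsComputable {S : Type v} [Fintype S] [LinearOrder (Option S)]
    (f : Word.{u} S →. Word.{u} S) : Prop :=
  ∃ p : Program.{u} S, ∀ w : Word.{u} S, (f w).map Subtype.val = interp p w.1

/-- The pseudocharacteristic function of a class of words: value `o` on `A`, undefined elsewhere. -/
def pseudoChar {S : Type v} (o : S) (A : Set (Word.{u} S)) : Word.{u} S →. Word.{u} S :=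
  fun w => ⟨w ∈ A, fun _ => singleWord o⟩

/-- Symmetric semidecidability. -/
def IsSemidecidable {S : Type v} [Fintype S] [LinearOrder (Option S)] (o : S)
    (A : Set (Word.{u} S)) : Prop :=
  IsComputable (pseudoChar o A)

/-- Symmetric computable enumerability: for some transfinite program, `A` is the class of all
outputs on inputs representing ordinals. -/
def IsCE {S : Type v} [Fintype S] [LinearOrder (Option S)] (o : S)
    (A : Set (Word.{u} S)) : Prop :=
  ∃ p : Program.{u} S, Subtype.val '' A = {y | ∃ α : Ordinal.{u}, y ∈ interp p (ordTape o α)}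

/-- The symmetry condition: the class of all words is symmetrically computably enumerable. -/
def SymmetryCondition (S : Type v) [Fintype S] [LinearOrder (Option S)] (o : S) : Prop :=
  IsCE o (Set.univ : Set (Word.{u} S))

end SymMachine

end

namespace SymMachine

open Ordinal Order

/-! ### Sampling a transfinite computation every `K` steps. -/

section Time

/-! One direction needs only that the class of all words is semidecidable: a program that writes the
symbol in cell 0 and erases everything to the right up to the first empty cell does this.

For the other direction let `q` enumerate all words and let `p` semidecide `A`. The new program runs
`q`, tests the result with `p`, and outputs the tested word. Since `p` destroys its input, the word
must survive on a second track. Instead of stretching the output `v` of `q` to make room, the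
program takes as candidate the word `w` standing in the even cells of `v`. No candidate is lost:
every `w` is the even part of the word that repeats each entry of `w` twice, and `q` enumerates that
word too. So `w` is copied into the odd cells (`computation_copy`), and `p` is simulated on the even
cells (`computation_simulate`), doing each head motion twice. If `p` halts, its single output symbol
is erased, and `w` must be moved from the odd cells to its proper place. This takes `ω` passes
(`computation_compress`). Each pass moves every symbol that is not yet in place one cell to the
left. As `2 * ω = ω`, a symbol stays within its block of length `ω` and needs only finitely many
moves. Each cell is thus eventually constant, and the limit rule produces `w`.

States are coded as `ω * x + j`, with `x` the phase (or the simulated state) and `j` a finite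
auxiliary index. The map `δ ↦ ω * (b + δ)` is normal, so it commutes with inferior limits, and
auxiliary states never pull an inferior limit down. Phases after the first have `x ≥ 1`, so the halt
state 1 is not met by accident. The head returns to cell 0 by running through `ω` increasing states:
the limit state has not occurred before, so the supremum that defines the head position is empty.

The bookkeeping rests on `computation_hub`, which reduces a computation with a bounded number of
auxiliary steps to prescribed snapshots. -/

theorem exists_time_eq {T N t : Ordinal.{u}} {K : ℕ} (hT : T ≤ t) (ht : t < T + K * N) :
    ∃ η < N, ∃ j < K, t = T + K * η + (j : ℕ) := by
  obtain ⟨d, rfl⟩ := le_iff_exists_add.1 hT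
  rw [add_lt_add_iff_left] at ht
  obtain ⟨η, hη, r, hr, rfl⟩ := lt_mul_iff.1 ht
  obtain ⟨j, rfl⟩ := lt_omega0.1 (hr.trans (natCast_lt_omega0 K))
  exact ⟨η, hη, j, by exact_mod_cast hr, by rw [add_assoc]⟩

theorem time_lt {T η μ : Ordinal.{u}} {K : ℕ} (hη : η < μ) {j : ℕ} (hj : j < K) :
    T + K * η + (j : ℕ) < T + K * μ := by
  have h1 : η + 1 ≤ μ := add_one_le_iff.2 hη
  calc T + K * η + (j : ℕ) < T + K * η + (K : ℕ) := by
        rw [add_lt_add_iff_left]; exact_mod_cast hj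
    _ = T + K * (η + 1) := by rw [mul_add_one, add_assoc]
    _ ≤ T + K * μ := by gcongr

theorem time_lt' {T η μ : Ordinal.{u}} {K : ℕ} (hK : 0 < K) (hη : η < μ) :
    T + K * η < T + K * μ := by
  simpa using time_lt (T := T) hη hK

theorem le_time_iff {T η μ : Ordinal.{u}} {K : ℕ} (hK : 0 < K) :
    T + K * η ≤ T + K * μ ↔ η ≤ μ :=
  ⟨fun h => not_lt.1 fun h' => (time_lt' hK h').not_ge h, fun h => by gcongr⟩

theorem le_of_time_le {T η ξ : Ordinal.{u}} {K j : ℕ} (hj : j < K)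
    (h : T + K * ξ ≤ T + K * η + (j : ℕ)) : ξ ≤ η :=
  not_lt.1 fun h' => (time_lt h' hj).not_ge h

theorem isSuccLimit_time {T μ : Ordinal.{u}} {K : ℕ} (hK : 0 < K) (hμ : IsSuccLimit μ) :
    IsSuccLimit (T + K * μ) :=
  (isNormal_add_right T).map_isSuccLimit
    ((isNormal_mul_right (by exact_mod_cast hK)).map_isSuccLimit hμ)

theorem exists_time_ge {T μ t : Ordinal.{u}} {K : ℕ} (hμ : IsSuccLimit μ)
    (ht : t < T + K * μ) : ∃ η < μ, t ≤ T + K * η := by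
  rcases le_total T t with h | h
  · obtain ⟨η, hη, j, hj, rfl⟩ := exists_time_eq h ht
    refine ⟨η + 1, hμ.add_one_lt hη, ?_⟩
    rw [mul_add_one, ← add_assoc]
    gcongr
  · exact ⟨0, hμ.bot_lt, by simpa using h⟩

/-- The eventual lower bounds of a sequence sampled at the times `T + K * η` agree with those of
the whole sequence if the values in between are bounded below by neighbouring samples. -/
theorem exists_eventually_le_iff {α : Type*} [LinearOrder α] {T μ : Ordinal.{u}} {K : ℕ}
    (hK : 0 < K) (hμ : IsSuccLimit μ) {F G : Ordinal.{u} → α}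
    (hFG : ∀ η < μ, F (T + K * η) = G η)
    (hb : ∀ η < μ, ∀ j : ℕ, 0 < j → j < K →
      G η ≤ F (T + K * η + j) ∨ G (η + 1) ≤ F (T + K * η + j)) (a : α) :
    (∃ ξ : Set.Iio (T + K * μ), ∀ ζ : Set.Iio (T + K * μ), ξ ≤ ζ → a ≤ F ζ) ↔
      ∃ ξ : Set.Iio μ, ∀ ζ : Set.Iio μ, ξ ≤ ζ → a ≤ G ζ := by
  constructor
  · rintro ⟨⟨t, ht⟩, h⟩
    obtain ⟨ξ, hξ, htξ⟩ := exists_time_ge hμ ht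
    refine ⟨⟨ξ, hξ⟩, fun ⟨ζ, hζ⟩ hle => ?_⟩
    rw [← hFG ζ hζ]
    exact h ⟨T + K * ζ, time_lt' hK hζ⟩ (htξ.trans ((le_time_iff hK).2 hle))
  -- A time between two samples has index `η ≥ ξ`, so a lower bound valid at the samples `η` and `η
  -- + 1` also bounds the value in between.
  · rintro ⟨⟨ξ, hξ⟩, h⟩
    refine ⟨⟨T + K * ξ, time_lt' hK hξ⟩, fun ⟨t, ht⟩ hle => ?_⟩
    obtain ⟨η, hη, j, hj, rfl⟩ := exists_time_eq (le_self_add.trans hle) ht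
    have hle' : ξ ≤ η := le_of_time_le hj hle
    have h1 := h ⟨η, hη⟩ hle'
    have h2 := h ⟨η + 1, hμ.add_one_lt hη⟩ (hle'.trans (le_add_of_nonneg_right zero_le))
    rcases Nat.eq_zero_or_pos j with rfl | hj0
    · simpa [hFG η hη] using h1
    · rcases hb η hη j hj0 hj with h3 | h3
      · exact h1.trans h3
      · exact h2.trans h3

end Time

/-! ### Inferior limits of symbols and of ordinals. -/

section Liminf

theorem symLiminf_congr {S : Type v} [Fintype S] [LinearOrder (Option S)] {l l' : Ordinal.{u}}
    {f : Set.Iio l → Option S} {g : Set.Iio l' → Option S}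
    (h : ∀ a, (∃ ξ, ∀ ζ, ξ ≤ ζ → a ≤ f ζ) ↔ ∃ ξ, ∀ ζ, ξ ≤ ζ → a ≤ g ζ) :
    symLiminf f = symLiminf g := by
  classical
  have hB : (Finset.univ.filter fun a => ∃ ξ, ∀ ζ, ξ ≤ ζ → a ≤ f ζ) =
      Finset.univ.filter fun a => ∃ ξ, ∀ ζ, ξ ≤ ζ → a ≤ g ζ :=
    Finset.filter_congr fun a _ => h a
  unfold symLiminf
  convert rfl using 3; simp only [h]

theorem symLiminf_eq_of_eventually {S : Type v} [Fintype S] [LinearOrder (Option S)]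
    {l : Ordinal.{u}} {f : Set.Iio l → Option S} {s : Option S}
    (h : ∃ ξ, ∀ ζ, ξ ≤ ζ → f ζ = s) : symLiminf f = s := by
  classical
  obtain ⟨ξ, hξ⟩ := h
  have key : ∀ a, (∃ ξ, ∀ ζ, ξ ≤ ζ → a ≤ f ζ) ↔ a ≤ s := by
    refine fun a => ⟨fun ⟨ξ', h'⟩ => ?_, fun ha => ⟨ξ, fun ζ hζ => (hξ ζ hζ).symm ▸ ha⟩⟩
    have := h' (max ξ ξ') (le_max_right _ _)
    rwa [hξ _ (le_max_left _ _)] at this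
  unfold symLiminf
  simp only [key]
  have hne : (Finset.univ.filter fun a => a ≤ s).Nonempty := ⟨s, by simp⟩
  rw [dif_pos hne]
  refine le_antisymm (Finset.max'_le _ _ _ fun a ha => by simpa using ha) ?_
  exact Finset.le_max' _ _ (by simp)

theorem bddAbove_liminf {l : Ordinal.{u}} (I : Set (Set.Iio l)) (f : Set.Iio l → Ordinal.{u}) :
    BddAbove {a | ∃ ξ ∈ I, ∀ ζ ∈ I, ξ ≤ ζ → a ≤ f ζ} := by
  have hs : BddAbove (Set.range f) := bddAbove_of_small
  obtain ⟨b, hb⟩ := hs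
  refine ⟨b, ?_⟩
  rintro a ⟨ξ, hξ, h⟩
  exact (h ξ hξ le_rfl).trans (hb ⟨ξ, rfl⟩)

theorem ordLiminf_empty {l : Ordinal.{u}} {I : Set (Set.Iio l)} (hI : I = ∅)
    (f : Set.Iio l → Ordinal.{u}) : ordLiminf I f = 0 := by
  subst hI
  simp [ordLiminf]

theorem ordLiminf_le {l : Ordinal.{u}} {I : Set (Set.Iio l)} {f : Set.Iio l → Ordinal.{u}}
    {b : Ordinal.{u}} (h : ∀ ξ ∈ I, ∃ ζ ∈ I, ξ ≤ ζ ∧ f ζ ≤ b) : ordLiminf I f ≤ b := by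
  rw [ordLiminf]
  refine csSup_le' ?_
  rintro a ⟨ξ, hξ, ha⟩
  obtain ⟨ζ, hζ, hle, hb⟩ := h ξ hξ
  exact (ha ζ hζ hle).trans hb

theorem le_ordLiminf {l : Ordinal.{u}} {I : Set (Set.Iio l)} {f : Set.Iio l → Ordinal.{u}}
    {b : Ordinal.{u}} (h : ∃ ξ ∈ I, ∀ ζ ∈ I, ξ ≤ ζ → b ≤ f ζ) : b ≤ ordLiminf I f :=
  le_csSup (bddAbove_liminf I f) h

/-- The inferior limit of a sequence that exceeds every `b < L` eventually, but not `L`. -/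
theorem ordLiminf_univ_eq {l : Ordinal.{u}} {f : Set.Iio l → Ordinal.{u}} {L : Ordinal.{u}}
    (h1 : ∀ b < L, ∃ ξ, ∀ ζ, ξ ≤ ζ → b < f ζ) (h2 : ∀ ξ, ∃ ζ, ξ ≤ ζ ∧ f ζ ≤ L) :
    ordLiminf Set.univ f = L := by
  refine le_antisymm (ordLiminf_le fun ξ _ => ?_) (le_of_forall_lt fun b hb => ?_)
  · obtain ⟨ζ, h, h'⟩ := h2 ξ
    exact ⟨ζ, trivial, h, h'⟩
  · obtain ⟨ξ, hξ⟩ := h1 b hb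
    exact add_one_le_iff.1
      (le_ordLiminf ⟨ξ, trivial, fun ζ _ hζ => add_one_le_iff.2 (hξ ζ hζ)⟩)

/-- Monotonicity carries `g` past the minima, continuity past the supremum. Over an empty index
class the inferior limit is 0, whence the alternative `g 0 = 0`. It is needed for head positions,
since the limit state may never have occurred. -/
theorem ordLiminf_comp_of_isNormal {l : Ordinal.{u}} {I : Set (Set.Iio l)}
    {f : Set.Iio l → Ordinal.{u}} {g : Ordinal.{u} → Ordinal.{u}} (hg : IsNormal g)
    (h0 : g 0 = 0 ∨ I.Nonempty) :
    ordLiminf I (fun ξ => g (f ξ)) = g (ordLiminf I f) := by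
  rcases I.eq_empty_or_nonempty with hI | ⟨ξ₀, hξ₀⟩
  · rw [ordLiminf_empty hI, ordLiminf_empty hI]
    rcases h0 with h0 | h0
    · exact h0.symm
    · exact absurd hI h0.ne_empty
  · have hne : {a | ∃ ξ ∈ I, ∀ ζ ∈ I, ξ ≤ ζ → a ≤ f ζ}.Nonempty :=
      ⟨0, ξ₀, hξ₀, fun _ _ _ => zero_le⟩
    apply le_antisymm
    · rw [ordLiminf]
      refine csSup_le' ?_
      rintro a ⟨ξ, hξ, h⟩
      -- The minimum of `f` beyond `ξ` is attained, at `ζ'`. It is an eventual lower bound of `f`,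
      -- and its image under `g` dominates `a`.
      obtain ⟨_, ⟨ζ', ⟨hζ', hle'⟩, rfl⟩, hmin⟩ := (wellFounded_lt (α := Ordinal.{u})).has_min
        (f '' {ζ | ζ ∈ I ∧ ξ ≤ ζ}) ⟨f ξ, ξ, ⟨hξ, le_rfl⟩, rfl⟩
      refine (h ζ' hζ' hle').trans (hg.monotone (le_ordLiminf ⟨ξ, hξ, fun z hz hxz => ?_⟩))
      exact not_lt.1 (hmin _ ⟨z, ⟨hz, hxz⟩, rfl⟩)
    · rw [ordLiminf, hg.map_sSup hne (bddAbove_liminf I f)]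
      refine csSup_le' ?_
      rintro _ ⟨a, ⟨ξ, hξ, h⟩, rfl⟩
      exact le_ordLiminf ⟨ξ, hξ, fun ζ hζ hle => hg.monotone (h ζ hζ hle)⟩

end Liminf

/-! ### Unfolding computations, and reducing them to prescribed snapshots. -/

section Computation

variable {S : Type v} [Fintype S] [LinearOrder (Option S)]

theorem computation_zero (p : Program.{u} S) (s : Snapshot.{u} S) : computation p s 0 = s := by
  simp [computation]

theorem computation_add_one (p : Program.{u} S) (s : Snapshot.{u} S) (γ : Ordinal.{u}) :
    computation p s (γ + 1) = step p (computation p s γ) := by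
  simp [computation, limitRecOn_add_one]

theorem computation_limit (p : Program.{u} S) (s : Snapshot.{u} S) {l : Ordinal.{u}}
    (hl : IsSuccLimit l) :
    computation p s l = limitSnapshot fun ξ : Set.Iio l => computation p s ξ.1 := by
  simp [computation, limitRecOn_limit, hl]

theorem computation_add_nat (p : Program.{u} S) (s : Snapshot.{u} S) (γ : Ordinal.{u}) (n : ℕ) :
    computation p s (γ + n) = (step p)^[n] (computation p s γ) := by
  induction n with
  | zero => simp
  | succ n ih => rw [Nat.cast_succ, ← add_assoc, computation_add_one, ih,
      Function.iterate_succ_apply']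

theorem Snapshot.ext' {S : Type v} {s t : Snapshot.{u} S} (h1 : s.tape = t.tape) (h2 : s.state = t.state)
    (h3 : s.head = t.head) : s = t := by
  cases s; cases t; simp_all

theorem step_eq {S : Type v} {p : Program.{u} S} {s : Snapshot.{u} S} {δ : Ordinal.{u}} {σ : Option S}
    {m : Motion} (h : p.toFun (s.state, s.tape s.head) = some (δ, σ, m)) :
    step p s = ⟨Function.update s.tape s.head σ, δ, move m s.head⟩ := by
  simp [step, h]

theorem step_write {S : Type v} {p : Program.{u} S} {X : Tape.{u} S} {q h δ : Ordinal.{u}}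
    {a σ : Option S} {m : Motion} (ha : X h = a) (hp : p.toFun (q, a) = some (δ, σ, m)) :
    step p ⟨X, q, h⟩ = ⟨Function.update X h σ, δ, move m h⟩ :=
  step_eq (s := ⟨X, q, h⟩) (by rw [← hp, ← ha])

theorem step_keep {S : Type v} {p : Program.{u} S} {X : Tape.{u} S} {q h δ : Ordinal.{u}}
    {a : Option S} {m : Motion} (ha : X h = a) (hp : p.toFun (q, a) = some (δ, a, m)) :
    step p ⟨X, q, h⟩ = ⟨X, δ, move m h⟩ := by
  rw [step_write ha hp, ← ha, Function.update_eq_self]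

/-- `t` is an admissible intermediate snapshot on the way from `s` to `s'`. -/
structure Between (s s' t : Snapshot.{u} S) : Prop where
  tape : ∀ c, t.tape c = s.tape c ∨ t.tape c = s'.tape c
  state : s.state ≤ t.state ∨ s'.state ≤ t.state

/-- A computation passes, at the times `T + K * η`, through prescribed snapshots `hub η`, if these
follow each other by `K` steps and, at limits, by the limit rule, and if the states at other times
differ from the states of the `hub η`. -/
theorem computation_hub {p : Program.{u} S} {s₀ : Snapshot.{u} S} {K : ℕ} (hK : 0 < K)
    {T N : Ordinal.{u}} {hub : Ordinal.{u} → Snapshot.{u} S} {P : Ordinal.{u} → Prop}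
    (h0 : computation p s₀ T = hub 0)
    (hs : ∀ η < N, (step p)^[K] (hub η) = hub (η + 1))
    (hm : ∀ η < N, ∀ j, 0 < j → j < K →
      Between (hub η) (hub (η + 1)) ((step p)^[j] (hub η)) ∧ P ((step p)^[j] (hub η)).state)
    (hl : ∀ μ ≤ N, IsSuccLimit μ → limitSnapshot (fun ξ : Set.Iio μ => hub ξ.1) = hub μ)
    (hP : ∀ η ≤ N, ¬ P (hub η).state)
    (hh : ∀ t < T, ∀ η ≤ N, (computation p s₀ t).state ≠ (hub η).state) :
    ∀ η ≤ N, computation p s₀ (T + K * η) = hub η := by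
  intro η
  induction η using limitRecOn with
  | zero => intro _; simpa using h0
  | add_one η ih =>
    intro hη
    have hη' : η < N := add_one_le_iff.1 hη
    rw [mul_add_one, ← add_assoc, computation_add_nat, ih hη'.le, hs η hη']
  | limit μ hμ ih =>
    intro hη
    set C := computation p s₀ with hC
    have hhub : ∀ η < μ, C (T + K * η) = hub η := fun η h => ih η h (h.le.trans hη)
    have hbet : ∀ η < μ, ∀ j : ℕ, 0 < j → j < K →
        Between (hub η) (hub (η + 1)) (C (T + K * η + j)) ∧ P (C (T + K * η + j)).state := by
      intro η h j hj hjK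
      rw [hC, computation_add_nat, ← hC, hhub η h]
      exact hm η (h.trans_le hη) j hj hjK
    rw [← hl μ hη hμ, hC, computation_limit p s₀ (isSuccLimit_time hK hμ), ← hC]
    have hst : ordLiminf Set.univ (fun ξ : Set.Iio (T + K * μ) => (C ξ.1).state) =
        ordLiminf Set.univ (fun ξ : Set.Iio μ => (hub ξ.1).state) := by
      unfold ordLiminf
      congr 1
      ext a
      simpa using exists_eventually_le_iff (T := T) hK hμ (F := fun t => (C t).state)
        (G := fun t => (hub t).state) (fun η h => by rw [hhub η h])
        (fun η h j hj hjK => (hbet η h j hj hjK).1.state) a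
    refine Snapshot.ext' ?_ hst ?_
    · funext c
      refine symLiminf_congr fun a => ?_
      refine exists_eventually_le_iff (T := T) hK hμ (F := fun t => (C t).tape c)
        (G := fun t => (hub t).tape c) (fun η h => by rw [hhub η h])
        (fun η h j hj hjK => ?_) a
      exact ((hbet η h j hj hjK).1.tape c).imp (fun h => h.ge) (fun h => h.ge)
    · have hL : (hub μ).state = ordLiminf Set.univ (fun ξ : Set.Iio μ => (hub ξ.1).state) := by
        rw [← hl μ hη hμ]; rfl
      -- The head rule only looks at times carrying the limit state. These are sampling times:
      -- states before `T` are excluded by `hh`, and auxiliary states satisfy `P`, which no hub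
      -- state does.
      have hI : ∀ t : Set.Iio (T + K * μ), (C t.1).state = (hub μ).state →
          ∃ η < μ, t.1 = T + K * η := by
        rintro ⟨t, ht⟩ hst'
        rcases lt_or_ge t T with h | h
        · exact absurd hst' (hh t h μ hη)
        · obtain ⟨η, hη', j, hj, rfl⟩ := exists_time_eq h ht
          rcases Nat.eq_zero_or_pos j with rfl | hj0
          · exact ⟨η, hη', by simp⟩
          · have := (hbet η hη' j hj0 hj).2
            simp only at hst'
            rw [hst'] at this
            exact absurd this (hP μ hη)
      change ordLiminf _ _ = ordLiminf _ _
      rw [hst, ← hL]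
      unfold ordLiminf
      congr 1
      ext a
      constructor
      · rintro ⟨t, ht, h⟩
        obtain ⟨ξ, hξ, htξ⟩ := hI t ht
        refine ⟨⟨ξ, hξ⟩, ?_, fun ⟨ζ, hζ⟩ hζI hle => ?_⟩
        · have ht' : (C t.1).state = (hub μ).state := ht
          rwa [htξ, hhub ξ hξ] at ht'
        · have := h ⟨T + K * ζ, time_lt' hK hζ⟩
            (by simpa [hhub ζ hζ] using hζI)
            (by rw [← Subtype.coe_le_coe, htξ]; exact (le_time_iff hK).2 hle)
          simpa [hhub ζ hζ] using this
      · rintro ⟨⟨ξ, hξ⟩, hξI, h⟩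
        refine ⟨⟨T + K * ξ, time_lt' hK hξ⟩, by simpa [hhub ξ hξ] using hξI, ?_⟩
        intro t ht hle
        obtain ⟨ζ, hζ, htζ⟩ := hI t ht
        have ht' : (C t.1).state = (hub μ).state := ht
        rw [htζ, hhub ζ hζ] at ht'
        change a ≤ (C t.1).head
        rw [htζ, hhub ζ hζ]
        refine h ⟨ζ, hζ⟩ ht' ?_
        rw [← Subtype.coe_le_coe, htζ] at hle
        exact (le_time_iff hK).1 hle

/-- What happens between the times at which a computation passes through `hub η`. -/
theorem computation_between {p : Program.{u} S} {s₀ : Snapshot.{u} S} {K : ℕ}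
    {T N : Ordinal.{u}} {hub : Ordinal.{u} → Snapshot.{u} S} {P : Ordinal.{u} → Prop}
    (hm : ∀ η < N, ∀ j, 0 < j → j < K →
      Between (hub η) (hub (η + 1)) ((step p)^[j] (hub η)) ∧ P ((step p)^[j] (hub η)).state)
    (hC : ∀ η ≤ N, computation p s₀ (T + K * η) = hub η) {t : Ordinal.{u}} (hT : T ≤ t)
    (ht : t < T + K * N) :
    ∃ η < N, computation p s₀ t = hub η ∨
      Between (hub η) (hub (η + 1)) (computation p s₀ t) ∧ P (computation p s₀ t).state := by
  obtain ⟨η, hη, j, hj, rfl⟩ := exists_time_eq hT ht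
  refine ⟨η, hη, ?_⟩
  rw [computation_add_nat, hC η hη.le]
  rcases Nat.eq_zero_or_pos j with rfl | hj0
  · exact Or.inl rfl
  · exact Or.inr (hm η hη j hj0 hj)

/-- The limit rule when the states tend to a state that was not assumed before. -/
theorem limitSnapshot_of_fresh {l : Ordinal.{u}} {s : Set.Iio l → Snapshot.{u} S}
    {X : Tape.{u} S} {L : Ordinal.{u}} (h1 : ∀ ξ, (s ξ).state < L)
    (h2 : ∀ b < L, ∃ ξ, ∀ ζ, ξ ≤ ζ → b < (s ζ).state)
    (h3 : ∀ c, ∃ ξ, ∀ ζ, ξ ≤ ζ → (s ζ).tape c = X c) :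
    limitSnapshot s = ⟨X, L, 0⟩ := by
  have hst : ordLiminf Set.univ (fun ξ => (s ξ).state) = L :=
    ordLiminf_univ_eq h2 fun ξ => ⟨ξ, le_rfl, (h1 ξ).le⟩
  refine Snapshot.ext' (funext fun c => symLiminf_eq_of_eventually (h3 c)) hst ?_
  -- The state `L` did not occur earlier, so no head position is taken into account and the
  -- convention `sup ∅ = 0` sends the head to cell 0.
  refine ordLiminf_empty ?_ _
  rw [hst]
  exact Set.eq_empty_of_forall_notMem fun ξ hξ => (h1 ξ).ne hξ

/-- The limit rule at constant state, when the head positions exceed each `b < h` eventually. -/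
theorem limitSnapshot_of_const_state {l : Ordinal.{u}} {s : Set.Iio l → Snapshot.{u} S}
    {X : Tape.{u} S} {L h : Ordinal.{u}} (hl : 0 < l) (h1 : ∀ ξ, (s ξ).state = L)
    (h2 : ∀ b < h, ∃ ξ, ∀ ζ, ξ ≤ ζ → b < (s ζ).head) (h2' : ∀ ξ, (s ξ).head ≤ h)
    (h3 : ∀ c, ∃ ξ, ∀ ζ, ξ ≤ ζ → (s ζ).tape c = X c) :
    limitSnapshot s = ⟨X, L, h⟩ := by
  have hst : ordLiminf Set.univ (fun ξ => (s ξ).state) = L :=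
    ordLiminf_univ_eq (fun b hb => ⟨⟨0, hl⟩, fun ζ _ => by rwa [h1]⟩)
      fun ξ => ⟨ξ, le_rfl, (h1 ξ).le⟩
  refine Snapshot.ext' (funext fun c => symLiminf_eq_of_eventually (h3 c)) hst ?_
  change ordLiminf _ _ = h
  rw [hst]
  have : {ξ | (s ξ).state = L} = Set.univ := Set.eq_univ_of_forall h1
  rw [this]
  exact ordLiminf_univ_eq h2 fun ξ => ⟨ξ, le_rfl, h2' ξ⟩

end Computation

/-! ### Coding a phase and a finite index by an ordinal `ω * x + j`. -/

section StateCode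

theorem omega_mul_add_lt {x y : Ordinal.{u}} (h : x < y) (j : ℕ) : ω * x + j < ω * y :=
  calc ω * x + (j : Ordinal) < ω * x + ω := by
        rw [add_lt_add_iff_left]; exact natCast_lt_omega0 j
    _ = ω * (x + 1) := (mul_add_one _ _).symm
    _ ≤ ω * y := by gcongr; exact add_one_le_iff.2 h

theorem omega_mul_lt {x y : Ordinal.{u}} (h : x < y) : ω * x < ω * y := by
  simpa using omega_mul_add_lt h 0

theorem omega_mul_le {x y : Ordinal.{u}} (h : x ≤ y) : ω * x ≤ ω * y := by gcongr

theorem omega_mul_add_div (x : Ordinal.{u}) (j : ℕ) : (ω * x + j) / ω = x := by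
  rw [mul_add_div _ omega0_ne_zero, div_eq_zero_of_lt (natCast_lt_omega0 j), add_zero]

theorem omega_mul_add_mod (x : Ordinal.{u}) (j : ℕ) : (ω * x + j) % ω = j := by
  rw [mul_add_mod_self, natCast_mod_omega0]

theorem exists_eq_omega_mul_add (o : Ordinal.{u}) : ∃ x, ∃ j : ℕ, o = ω * x + j := by
  obtain ⟨j, hj⟩ := lt_omega0.1 (mod_lt o omega0_ne_zero)
  exact ⟨o / ω, j, by rw [← hj, div_add_mod]⟩

theorem one_lt_omega_mul {x : Ordinal.{u}} (h : 1 ≤ x) : 1 < ω * x :=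
  one_lt_omega0.trans_le (by simpa using omega_mul_le h)

end StateCode

/-! ### Building blocks of programs: head reset, walks, simulation, halting. -/

section Run

variable {S : Type v} [Fintype S] [LinearOrder (Option S)]

/-- Before time `T`, the states are below `b` and different from the halt state. -/
def RunsBelow (p : Program.{u} S) (s : Snapshot.{u} S) (T b : Ordinal.{u}) : Prop :=
  ∀ t < T, (computation p s t).state < b ∧ (computation p s t).state ≠ 1

theorem RunsBelow.mono {p : Program.{u} S} {s : Snapshot.{u} S} {T b b' : Ordinal.{u}}
    (h : RunsBelow p s T b) (hb : b ≤ b') : RunsBelow p s T b' :=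
  fun t ht => ⟨(h t ht).1.trans_le hb, (h t ht).2⟩

theorem RunsBelow.add_one {p : Program.{u} S} {s : Snapshot.{u} S} {T b : Ordinal.{u}}
    (h : RunsBelow p s T b) (hb : (computation p s T).state < b)
    (h1 : (computation p s T).state ≠ 1) : RunsBelow p s (T + 1) b := by
  intro t ht
  rcases (lt_add_one_iff.1 ht).lt_or_eq with h' | rfl
  · exact h t h'
  · exact ⟨hb, h1⟩

section Jump

variable {r : Program.{u} S} {s₀ : Snapshot.{u} S} {T x h : Ordinal.{u}} {X : Tape.{u} S} {j₀ : ℕ}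

/-- Staying in place through the states `ω * x + j` for `ω` many steps brings the head back to
the cell `0`. -/
theorem computation_jump (hx : 1 ≤ x)
    (hr : ∀ j : ℕ, j₀ ≤ j → ∀ s, r.toFun (ω * x + j, s) =
      some (ω * x + (j + 1 : ℕ), s, Motion.stay))
    (h0 : computation r s₀ T = ⟨X, ω * x + j₀, h⟩) (hh : RunsBelow r s₀ T (ω * (x + 1))) :
    computation r s₀ (T + ω) = ⟨X, ω * (x + 1), 0⟩ ∧ RunsBelow r s₀ (T + ω) (ω * (x + 1)) ∧
      ∀ t, T ≤ t → t < T + ω →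
        ω * x ≤ (computation r s₀ t).state ∧ (computation r s₀ t).tape = X := by
  have hn : ∀ n : ℕ, computation r s₀ (T + n) = ⟨X, ω * x + (j₀ + n : ℕ), h⟩ := by
    intro n
    induction n with
    | zero => simpa using h0
    | succ n ih =>
      rw [Nat.cast_succ, ← add_assoc, computation_add_one, ih,
        step_eq (hr (j₀ + n) (Nat.le_add_right _ _) _)]
      simp [move, add_assoc]
  have ht : ∀ t, T ≤ t → t < T + ω → ∃ n : ℕ, t = T + n := by
    intro t h1 h2
    obtain ⟨d, rfl⟩ := le_iff_exists_add.1 h1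
    rw [add_lt_add_iff_left] at h2
    obtain ⟨n, rfl⟩ := lt_omega0.1 h2
    exact ⟨n, rfl⟩
  have hrun : RunsBelow r s₀ (T + ω) (ω * (x + 1)) := by
    intro t h1
    rcases lt_or_ge t T with h2 | h2
    · exact hh t h2
    · obtain ⟨n, rfl⟩ := ht t h2 h1
      rw [hn]
      exact ⟨omega_mul_add_lt (lt_add_one x) _,
        ((one_lt_omega_mul hx).trans_le le_self_add).ne'⟩
  refine ⟨?_, hrun, ?_⟩
  · rw [computation_limit _ _ ((isNormal_add_right T).map_isSuccLimit isSuccLimit_omega0)]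
    -- The states `ω * x + j` increase to `ω * (x + 1)`, which is new because all states so far lie
    -- below it.
    refine limitSnapshot_of_fresh (fun ξ => (hrun ξ.1 ξ.2).1) ?_ ?_
    · intro b hb
      have : ∃ n : ℕ, b < ω * x + n := by
        rcases lt_or_ge b (ω * x) with h1 | h1
        · exact ⟨0, by simpa using h1⟩
        · obtain ⟨d, rfl⟩ := le_iff_exists_add.1 h1
          rw [mul_add_one, add_lt_add_iff_left] at hb
          obtain ⟨n, rfl⟩ := lt_omega0.1 hb
          exact ⟨n + 1, by push_cast; rw [add_lt_add_iff_left]; exact lt_add_one _⟩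
      obtain ⟨n, hn'⟩ := this
      refine ⟨⟨T + n, by simp⟩, fun ζ hζ => ?_⟩
      have hζ' : T + n ≤ ζ.1 := hζ
      obtain ⟨m, hm⟩ := ht ζ.1 (le_self_add.trans hζ') ζ.2
      rw [hm] at hζ' ⊢
      rw [hn]
      refine hn'.trans_le ?_
      have : n ≤ m := by simpa using hζ'
      have : n ≤ j₀ + m := by omega
      change ω * x + (n : Ordinal) ≤ ω * x + ((j₀ + m : ℕ) : Ordinal)
      gcongr
    · intro c
      refine ⟨⟨T, lt_add_of_pos_right T omega0_pos⟩, fun ζ hζ => ?_⟩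
      obtain ⟨m, hm⟩ := ht ζ.1 hζ ζ.2
      rw [hm, hn]
  · intro t h1 h2
    obtain ⟨n, rfl⟩ := ht t h1 h2
    rw [hn]
    exact ⟨le_self_add, rfl⟩

end Jump

section Walk

/-- A walk: in the state `L`, the head visits the cells `pos η`, changing the tape from `Y η` to
`Y (η + 1)` in between, with higher states and `K` steps for each `η`. -/
theorem computation_walk {r : Program.{u} S} {s₀ : Snapshot.{u} S} {T N L L' : Ordinal.{u}}
    {K : ℕ} (hK : 0 < K) {Y : Ordinal.{u} → Tape.{u} S} {pos : Ordinal.{u} → Ordinal.{u}}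
    (h0 : computation r s₀ T = ⟨Y 0, L, pos 0⟩)
    (hs : ∀ η < N, (step r)^[K] ⟨Y η, L, pos η⟩ = ⟨Y (η + 1), L, pos (η + 1)⟩)
    (hm : ∀ η < N, ∀ j, 0 < j → j < K →
      (∀ c, ((step r)^[j] ⟨Y η, L, pos η⟩).tape c = Y η c ∨
        ((step r)^[j] ⟨Y η, L, pos η⟩).tape c = Y (η + 1) c) ∧
      L < ((step r)^[j] ⟨Y η, L, pos η⟩).state ∧ ((step r)^[j] ⟨Y η, L, pos η⟩).state < L')
    (hp1 : ∀ η, η ≤ pos η)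
    (hp2 : ∀ μ, IsSuccLimit μ → pos μ = μ ∧ ∀ η < μ, pos η < μ)
    (hY : ∀ μ ≤ N, IsSuccLimit μ → ∀ c, ∃ ξ < μ, ∀ ζ, ξ ≤ ζ → ζ < μ → Y ζ c = Y μ c)
    (hh : RunsBelow r s₀ T L) (hL : L < L') (hL1 : 1 < L) :
    computation r s₀ (T + K * N) = ⟨Y N, L, pos N⟩ ∧ RunsBelow r s₀ (T + K * N) L' ∧
      ∀ t, T ≤ t → t < T + K * N → L ≤ (computation r s₀ t).state ∧
        ∃ η < N, ∀ c, (computation r s₀ t).tape c = Y η c ∨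
          (computation r s₀ t).tape c = Y (η + 1) c := by
  have hm' : ∀ η < N, ∀ j, 0 < j → j < K →
      Between ⟨Y η, L, pos η⟩ ⟨Y (η + 1), L, pos (η + 1)⟩ ((step r)^[j] ⟨Y η, L, pos η⟩) ∧
        (L < ((step r)^[j] ⟨Y η, L, pos η⟩).state ∧
          ((step r)^[j] ⟨Y η, L, pos η⟩).state < L') :=
    fun η hη j hj hjK => ⟨⟨(hm η hη j hj hjK).1, Or.inl (hm η hη j hj hjK).2.1.le⟩,
      (hm η hη j hj hjK).2⟩
  have hC := computation_hub (p := r) (s₀ := s₀) (T := T) (N := N)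
    (hub := fun η => ⟨Y η, L, pos η⟩) (P := fun a => L < a ∧ a < L') hK h0 hs hm' ?_
    (fun η _ h => lt_irrefl _ h.1) (fun t ht η _ => (hh t ht).1.ne)
  · have hbet : ∀ t, T ≤ t → t < T + K * N → (L ≤ (computation r s₀ t).state ∧
        (computation r s₀ t).state < L') ∧ ∃ η < N, ∀ c, (computation r s₀ t).tape c = Y η c ∨
          (computation r s₀ t).tape c = Y (η + 1) c := by
      intro t h1 h2
      obtain ⟨η, hη, h⟩ := computation_between (hub := fun η => ⟨Y η, L, pos η⟩)
        (P := fun a => L < a ∧ a < L') hm' hC h1 h2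
      rcases h with h | h
      · rw [h]
        exact ⟨⟨le_rfl, hL⟩, η, hη, fun c => Or.inl rfl⟩
      · exact ⟨⟨h.2.1.le, h.2.2⟩, η, hη, h.1.tape⟩
    refine ⟨hC N le_rfl, fun t ht => ?_, fun t h1 h2 => ⟨(hbet t h1 h2).1.1, (hbet t h1 h2).2⟩⟩
    rcases lt_or_ge t T with h | h
    · exact ⟨(hh t h).1.trans hL, (hh t h).2⟩
    · have := (hbet t h ht).1
      exact ⟨this.2, (hL1.trans_le this.1).ne'⟩
  · intro μ hμ hlim
    -- All hubs carry the state `L`, so all their head positions count. From `η ≤ pos η < μ` the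
    -- inferior limit is `μ = pos μ`.
    refine limitSnapshot_of_const_state hlim.bot_lt (fun _ => rfl) ?_ ?_ ?_
    · intro b hb
      rw [(hp2 μ hlim).1] at hb
      exact ⟨⟨b + 1, hlim.add_one_lt hb⟩, fun ζ hζ =>
        (add_one_le_iff.1 (show b + 1 ≤ ζ.1 from hζ)).trans_le (hp1 _)⟩
    · intro ξ
      rw [(hp2 μ hlim).1]
      exact ((hp2 μ hlim).2 ξ.1 ξ.2).le
    · intro c
      obtain ⟨ξ, hξ, h⟩ := hY μ hμ hlim c
      exact ⟨⟨ξ, hξ⟩, fun ζ hζ => h ζ.1 hζ ζ.2⟩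

end Walk

section Simulation

/-- The rule of a program, made total by standing still where it is undefined. -/
def Program.total (p : Program.{u} S) (q : Ordinal.{u} × Option S) :
    Ordinal.{u} × Option S × Motion :=
  (p.toFun q).getD (q.1, q.2, Motion.stay)

theorem step_eq_total {S : Type v} (p : Program.{u} S) (s : Snapshot.{u} S) :
    step p s = ⟨Function.update s.tape s.head (p.total (s.state, s.tape s.head)).2.1,
      (p.total (s.state, s.tape s.head)).1,
      move (p.total (s.state, s.tape s.head)).2.2 s.head⟩ := by
  unfold step Program.total
  rcases h : p.toFun (s.state, s.tape s.head) with _ | ⟨δ, σ, m⟩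
  · simp [move]
  · simp

/-- Numbers for the motion tokens. -/
def Motion.code : Motion → ℕ
  | .left => 1
  | .stay => 2
  | .right => 3

theorem Motion.code_ne_zero (m : Motion) : m.code ≠ 0 := by
  cases m <;> simp [Motion.code]

/-- An embedding of tapes along an injection of cells, the contents of the other cells being
fixed. -/
structure TapeEmbedding (E : Tape.{u} S → Tape.{u} S) (g : Ordinal.{u} → Ordinal.{u}) : Prop where
  apply : ∀ Y η, E Y (g η) = Y η
  other : ∀ c, (∃ η, c = g η) ∨ ∃ z, ∀ Y, E Y c = z

theorem TapeEmbedding.update {S : Type v} {E : Tape.{u} S → Tape.{u} S} {g : Ordinal.{u} → Ordinal.{u}}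
    (h : TapeEmbedding E g) (hg : Function.Injective g) (Y : Tape.{u} S) (η : Ordinal.{u})
    (σ : Option S) : E (Function.update Y η σ) = Function.update (E Y) (g η) σ := by
  funext c
  rcases h.other c with ⟨ξ, rfl⟩ | ⟨z, hz⟩
  · rw [h.apply]
    by_cases hξ : ξ = η
    · subst hξ; simp
    · rw [Function.update_of_ne hξ, Function.update_of_ne (hg.ne hξ), h.apply]
  · by_cases hc : c = g η
    · subst hc
      rw [h.apply]; simp
    · rw [Function.update_of_ne hc, hz, hz]

variable {p r : Program.{u} S} {x₀ s₀ : Snapshot.{u} S} {T b κ : Ordinal.{u}}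
  {E : Tape.{u} S → Tape.{u} S} {g : Ordinal.{u} → Ordinal.{u}} {μ : Motion → Motion}

/-- `r` simulates `p` with two steps for each step of `p`, where the state `δ` of `p` is represented
by `ω * (b + δ)` and the cell `η` by `g η`. -/
theorem computation_simulate (hb : 1 ≤ b) (hκ : ∀ γ, (computation p x₀ γ).state < κ)
    (hg : IsNormal g) (hg0 : g 0 = 0) (hE : TapeEmbedding E g)
    (hmove : ∀ m β, move (μ m) (move m (g β)) = g (move m β))
    (hr1 : ∀ δ < κ, δ ≠ 1 → ∀ s, r.toFun (ω * (b + δ), s) =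
      some (ω * (b + (p.total (δ, s)).1) + (p.total (δ, s)).2.2.code, (p.total (δ, s)).2.1,
        (p.total (δ, s)).2.2))
    (hr2 : ∀ δ < κ, ∀ m : Motion, ∀ s, r.toFun (ω * (b + δ) + m.code, s) =
      some (ω * (b + δ), s, μ m))
    (h0 : computation r s₀ T = ⟨E x₀.tape, ω * (b + x₀.state), g x₀.head⟩)
    (hh : RunsBelow r s₀ T (ω * b)) {N : Ordinal.{u}}
    (hN : ∀ η < N, (computation p x₀ η).state ≠ 1) :
    computation r s₀ (T + 2 * N) = ⟨E (computation p x₀ N).tape,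
      ω * (b + (computation p x₀ N).state), g (computation p x₀ N).head⟩ ∧
    RunsBelow r s₀ (T + 2 * N) (ω * (b + κ)) := by
  set D := computation p x₀ with hD
  set hub : Ordinal.{u} → Snapshot.{u} S :=
    fun η => ⟨E (D η).tape, ω * (b + (D η).state), g (D η).head⟩ with hhub
  have hinj := hg.strictMono.injective
  have hstep1 : ∀ η < N, ∃ m : Motion, ∃ h' , step r (hub η) =
      ⟨E (D (η + 1)).tape, ω * (b + (D (η + 1)).state) + m.code, h'⟩ ∧
        move (μ m) h' = g (D (η + 1)).head := by
    intro η hη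
    have h1 := hr1 (D η).state (hκ η) (hN η hη) ((hub η).tape (hub η).head)
    have h2 := step_eq (s := hub η) h1
    have hread : (hub η).tape (hub η).head = (D η).tape (D η).head := hE.apply _ _
    rw [hread] at h2
    have h3 : D (η + 1) = _ := (computation_add_one p x₀ η).trans (step_eq_total p (D η))
    refine ⟨(p.total ((D η).state, (D η).tape (D η).head)).2.2,
      move (p.total ((D η).state, (D η).tape (D η).head)).2.2 (g (D η).head), h2.trans ?_, ?_⟩
    · rw [h3, hE.update hinj]
    · rw [h3]
      exact hmove _ _
  have hstep2 : ∀ η < N, (step r)^[2] (hub η) = hub (η + 1) := by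
    intro η hη
    obtain ⟨m, h', h1, h2⟩ := hstep1 η hη
    rw [Function.iterate_succ_apply', Function.iterate_one, h1,
      step_eq (hr2 _ (hκ (η + 1)) m _)]
    simp [hhub, h2]
  -- The auxiliary state already codes the next state of `p`, plus a nonzero motion code. So it is
  -- bounded below by the next hub state, and its nonzero remainder modulo `ω` separates it from all
  -- hub states.
  have hm : ∀ η < N, ∀ j, 0 < j → j < 2 →
      Between (hub η) (hub (η + 1)) ((step r)^[j] (hub η)) ∧
        (((step r)^[j] (hub η)).state % ω ≠ 0 ∧
          ((step r)^[j] (hub η)).state < ω * (b + κ)) := by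
    intro η hη j hj hj2
    obtain rfl : j = 1 := by omega
    obtain ⟨m, h', h1, h2⟩ := hstep1 η hη
    rw [Function.iterate_one, h1]
    refine ⟨⟨fun c => Or.inr rfl, Or.inr le_self_add⟩, ?_, ?_⟩
    · simp only [omega_mul_add_mod]
      exact_mod_cast m.code_ne_zero
    · exact omega_mul_add_lt (by simpa using hκ (η + 1)) _
  have hC := computation_hub (p := r) (s₀ := s₀) (T := T) (N := N) (hub := hub)
    (P := fun a => a % ω ≠ 0 ∧ a < ω * (b + κ)) two_pos
    (by simp [hhub, hD, computation_zero, h0]) hstep2 hm ?_ ?_ ?_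
  · refine ⟨by simpa using hC N le_rfl, fun t ht => ?_⟩
    rcases lt_or_ge t T with h | h
    · exact ⟨(hh t h).1.trans_le (omega_mul_le le_self_add), (hh t h).2⟩
    · obtain ⟨η, hη, h' | h'⟩ := computation_between
        (P := fun a => a % ω ≠ 0 ∧ a < ω * (b + κ)) hm hC h (by simpa using ht)
      · rw [h']
        exact ⟨omega_mul_lt (by simpa using hκ η),
          (one_lt_omega_mul (hb.trans le_self_add)).ne'⟩
      · refine ⟨h'.2.2, ?_⟩
        rcases h'.1.state with h2 | h2
        · exact ((one_lt_omega_mul (hb.trans le_self_add)).trans_le h2).ne'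
        · exact ((one_lt_omega_mul (hb.trans le_self_add)).trans_le h2).ne'
  · intro l _ hl
    have hf : IsNormal fun δ : Ordinal.{u} => ω * (b + δ) :=
      (isNormal_mul_right omega0_pos).comp (isNormal_add_right b)
    have hDl : D l = limitSnapshot fun ξ : Set.Iio l => D ξ.1 := computation_limit p x₀ hl
    have hst : ordLiminf Set.univ (fun ξ : Set.Iio l => (hub ξ.1).state) =
        ω * (b + (D l).state) := by
      rw [hDl]
      exact ordLiminf_comp_of_isNormal (f := fun ξ : Set.Iio l => (D ξ.1).state) hf
        (Or.inr ⟨⟨0, hl.bot_lt⟩, trivial⟩)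
    refine Snapshot.ext' ?_ hst ?_
    · funext c
      rcases hE.other c with ⟨η, rfl⟩ | ⟨z, hz⟩
      · change symLiminf (fun ξ : Set.Iio l => E (D ξ.1).tape (g η)) = E (D l).tape (g η)
        simp only [hE.apply]
        rw [hDl]
        rfl
      -- A cell outside the range of `g` has constant content, which the limit rule preserves.
      · change symLiminf (fun ξ : Set.Iio l => E (D ξ.1).tape c) = E (D l).tape c
        simp only [hz]
        exact symLiminf_eq_of_eventually ⟨⟨0, hl.bot_lt⟩, fun _ _ => rfl⟩
    · change ordLiminf {ξ : Set.Iio l | (hub ξ.1).state =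
        ordLiminf Set.univ (fun ξ : Set.Iio l => (hub ξ.1).state)} _ = _
      rw [hst]
      -- As the coding of states is injective, both computations use the same times in the head
      -- rule.
      have : {ξ : Set.Iio l | (hub ξ.1).state = ω * (b + (D l).state)} =
          {ξ : Set.Iio l | (D ξ.1).state = (D l).state} := by
        ext ξ
        simp [hhub, omega0_ne_zero]
      rw [this]
      change ordLiminf _ _ = g (D l).head
      rw [show (D l).head = ordLiminf {ξ : Set.Iio l | (D ξ.1).state = (D l).state}
        (fun ξ => (D ξ.1).head) by rw [hDl]; rfl]
      exact ordLiminf_comp_of_isNormal hg (Or.inl hg0)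
  · rintro η _ ⟨h, -⟩
    exact h (by simp [hhub])
  · intro t ht η _
    exact ((hh t ht).1.trans_le (omega_mul_le le_self_add)).ne

/-- If the simulated computation does not halt, neither does the simulating one. -/
theorem computation_simulate_ne_one (hb : 1 ≤ b) (hκ : ∀ γ, (computation p x₀ γ).state < κ)
    (hg : IsNormal g) (hg0 : g 0 = 0) (hE : TapeEmbedding E g)
    (hmove : ∀ m β, move (μ m) (move m (g β)) = g (move m β))
    (hr1 : ∀ δ < κ, δ ≠ 1 → ∀ s, r.toFun (ω * (b + δ), s) =
      some (ω * (b + (p.total (δ, s)).1) + (p.total (δ, s)).2.2.code, (p.total (δ, s)).2.1,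
        (p.total (δ, s)).2.2))
    (hr2 : ∀ δ < κ, ∀ m : Motion, ∀ s, r.toFun (ω * (b + δ) + m.code, s) =
      some (ω * (b + δ), s, μ m))
    (h0 : computation r s₀ T = ⟨E x₀.tape, ω * (b + x₀.state), g x₀.head⟩)
    (hh : RunsBelow r s₀ T (ω * b)) (hN : ∀ η, (computation p x₀ η).state ≠ 1)
    (t : Ordinal.{u}) : (computation r s₀ t).state ≠ 1 := by
  -- Simulating `t + 1` steps covers more than `t` steps of `r`.
  have h := (computation_simulate hb hκ hg hg0 hE hmove hr1 hr2 h0 hh (N := t + 1)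
    fun η _ => hN η).2
  refine (h t ?_).2
  calc t < t + 1 := lt_add_one t
    _ = 1 * (t + 1) := (one_mul _).symm
    _ ≤ 2 * (t + 1) := by gcongr; exact one_le_two
    _ ≤ T + 2 * (t + 1) := le_add_self

end Simulation

section Bound

theorem Program.exists_bound {S : Type v} (p : Program.{u} S) :
    ∃ κ : Ordinal.{u}, ∀ q δ σ m, p.toFun q = some (δ, σ, m) → δ ≤ κ := by
  have := p.small_dom
  obtain ⟨κ, hκ⟩ := bddAbove_of_small (s := Set.range
    fun q : {q : Ordinal.{u} × Option S // (p.toFun q).isSome} => ((p.toFun q.1).get q.2).1)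
  refine ⟨κ, fun q δ σ m h => hκ ⟨⟨q, by simp [h]⟩, by simp [h]⟩⟩

/-- The domain of a program is a set, so the new states it can assign are bounded, and inferior
limits respect the bound. A bound independent of the input lets another program reserve one interval
of codes for the simulated states. -/
theorem exists_state_lt (p : Program.{u} S) :
    ∃ κ : Ordinal.{u}, ∀ x γ, (computation p ⟨x, 0, 0⟩ γ).state < κ := by
  obtain ⟨κ, hκ⟩ := p.exists_bound
  refine ⟨κ + 1, fun x γ => lt_add_one_iff.2 ?_⟩
  induction γ using limitRecOn with
  | zero => simp [computation_zero]
  | add_one γ ih =>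
    rw [computation_add_one]
    unfold step
    rcases h : p.toFun ((computation p ⟨x, 0, 0⟩ γ).state,
      (computation p ⟨x, 0, 0⟩ γ).tape (computation p ⟨x, 0, 0⟩ γ).head) with _ | ⟨δ, σ, m⟩
    · exact ih
    · exact hκ _ _ _ _ h
  | limit l hl ih =>
    rw [computation_limit _ _ hl]
    exact ordLiminf_le fun ξ _ => ⟨ξ, trivial, le_rfl, ih ξ.1 ξ.2⟩

end Bound

section Halting

/-- `RunsBelow` excludes the halt state before `T`, so `T` is the least halting time. -/
theorem interp_eq_some {r : Program.{u} S} {x : Tape.{u} S} {T b : Ordinal.{u}}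
    {s : Snapshot.{u} S} (h1 : computation r ⟨x, 0, 0⟩ T = s) (hs : s.state = 1)
    (h2 : RunsBelow r ⟨x, 0, 0⟩ T b) : interp r x = Part.some s.tape := by
  have hT : T ∈ haltTimes r x := by change _ = _; rw [h1, hs]
  have hinf : sInf (haltTimes r x) = T := by
    refine le_antisymm (csInf_le' hT) (le_csInf ⟨T, hT⟩ fun t ht => ?_)
    exact not_lt.1 fun h => (h2 t h).2 ht
  rw [Part.eq_some_iff]
  exact ⟨⟨T, hT⟩, show (computation r ⟨x, 0, 0⟩ (sInf (haltTimes r x))).tape = s.tape by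
    rw [hinf, h1]⟩

theorem interp_eq_none {r : Program.{u} S} {x : Tape.{u} S}
    (h : ∀ t, (computation r ⟨x, 0, 0⟩ t).state ≠ 1) : interp r x = Part.none := by
  rw [Part.eq_none_iff']
  rintro ⟨t, ht⟩
  exact h t ht

theorem exists_halt_of_mem {r : Program.{u} S} {x y : Tape.{u} S} (h : y ∈ interp r x) :
    ∃ T, (computation r ⟨x, 0, 0⟩ T).state = 1 ∧ (computation r ⟨x, 0, 0⟩ T).tape = y ∧
      ∀ t < T, (computation r ⟨x, 0, 0⟩ t).state ≠ 1 := by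
  obtain ⟨hne, rfl⟩ := h
  exact ⟨_, csInf_mem hne, rfl, fun t ht ht1 => notMem_of_lt_csInf' ht ht1⟩

theorem state_ne_one_of_interp_eq_none {r : Program.{u} S} {x : Tape.{u} S}
    (h : interp r x = Part.none) (t : Ordinal.{u}) : (computation r ⟨x, 0, 0⟩ t).state ≠ 1 := by
  rw [Part.eq_none_iff'] at h
  exact fun ht => h ⟨t, ht⟩

end Halting

end Run

/-! ### Head motions, and motions on every second cell. -/

section Moves

theorem move_right (β : Ordinal.{u}) : move .right β = β + 1 := rfl

theorem move_stay (β : Ordinal.{u}) : move .stay β = β := rfl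

theorem move_left_add_one (β : Ordinal.{u}) : move .left (β + 1) = β := by
  simp [move, limitRecOn_add_one]

theorem move_left_zero : move .left (0 : Ordinal.{u}) = 0 := by
  simp [move]

theorem move_left_limit {β : Ordinal.{u}} (h : IsSuccLimit β) : move .left β = 0 := by
  simp [move, limitRecOn_limit, h]

/-- The delicate case is moving left from a limit `β`: then `2 * β` is a limit too, the first motion
leads to 0 and the second stays there. -/
theorem move_move_two_mul (m : Motion) (β : Ordinal.{u}) :
    move m (move m (2 * β)) = 2 * move m β := by
  cases m with
  | stay => rfl
  | right => simp only [move_right, mul_add_one, add_assoc, one_add_one_eq_two]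
  | left =>
    induction β using limitRecOn with
    | zero => simp [move_left_zero]
    | add_one β _ =>
      have : 2 * (β + 1) = 2 * β + 1 + 1 := by rw [mul_add_one, add_assoc, one_add_one_eq_two]
      rw [this]
      simp only [move_left_add_one]
    | limit β hβ _ =>
      rw [move_left_limit hβ, move_left_limit ((isNormal_mul_right two_pos).map_isSuccLimit hβ),
        move_left_zero, mul_zero]

end Moves

/-! ### Two tracks on one tape: even and odd cells. -/

section Interleave

theorem exists_eq_two_mul (c : Ordinal.{u}) : ∃ η, c = 2 * η ∨ c = 2 * η + 1 := by
  have h := div_add_mod c 2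
  have h2 : c % 2 < 2 := mod_lt c two_ne_zero
  have h2' : c % 2 < 1 + 1 := by rwa [one_add_one_eq_two]
  rcases (lt_add_one_iff.1 h2').lt_or_eq with h3 | h3
  · rw [lt_one_iff] at h3
    exact ⟨c / 2, Or.inl (by rw [h3, add_zero] at h; exact h.symm)⟩
  · exact ⟨c / 2, Or.inr (by rw [h3] at h; exact h.symm)⟩

theorem two_mul_div_two (η : Ordinal.{u}) : 2 * η / 2 = η := mul_div_cancel _ two_ne_zero

theorem two_mul_add_one_div_two (η : Ordinal.{u}) : (2 * η + 1) / 2 = η := by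
  rw [mul_add_div _ two_ne_zero, div_eq_zero_of_lt one_lt_two, add_zero]

theorem two_mul_mod_two (η : Ordinal.{u}) : 2 * η % 2 = 0 := mul_mod _ _

theorem two_mul_add_one_mod_two (η : Ordinal.{u}) : (2 * η + 1) % 2 = 1 := by
  rw [mul_add_mod_self, mod_eq_of_lt one_lt_two]

theorem two_mul_ne_two_mul_add_one (η ξ : Ordinal.{u}) : 2 * η ≠ 2 * ξ + 1 := fun h => by
  have h' := congrArg (· % 2) h
  simp only [two_mul_mod_two, two_mul_add_one_mod_two] at h'
  exact zero_ne_one h'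

theorem two_mul_inj {η ξ : Ordinal.{u}} : 2 * η = 2 * ξ ↔ η = ξ :=
  (isNormal_mul_right two_pos).strictMono.injective.eq_iff

open Classical in
/-- The tape with `Y` in the even cells and `Z` in the odd cells. -/
noncomputable def interleave {S : Type v} (Y Z : Tape.{u} S) : Tape.{u} S :=
  fun c => if c % 2 = 0 then Y (c / 2) else Z (c / 2)

variable {S : Type v}

theorem interleave_even (Y Z : Tape.{u} S) (η : Ordinal.{u}) :
    interleave Y Z (2 * η) = Y η := by
  rw [interleave, if_pos (two_mul_mod_two η), two_mul_div_two]

theorem interleave_odd (Y Z : Tape.{u} S) (η : Ordinal.{u}) :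
    interleave Y Z (2 * η + 1) = Z η := by
  have : (2 * η + 1) % 2 ≠ 0 := by rw [two_mul_add_one_mod_two]; exact one_ne_zero
  rw [interleave, if_neg this, two_mul_add_one_div_two]

theorem eq_interleave {X Y Z : Tape.{u} S} (h1 : ∀ η, X (2 * η) = Y η)
    (h2 : ∀ η, X (2 * η + 1) = Z η) : X = interleave Y Z := by
  funext c
  obtain ⟨η, rfl | rfl⟩ := exists_eq_two_mul c
  · rw [h1, interleave_even]
  · rw [h2, interleave_odd]

theorem tapeEmbedding_interleave (Z : Tape.{u} S) :
    TapeEmbedding (fun Y => interleave Y Z) (fun η => 2 * η) where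
  apply Y η := interleave_even Y Z η
  other c := by
    obtain ⟨η, rfl | rfl⟩ := exists_eq_two_mul c
    · exact Or.inl ⟨η, rfl⟩
    · exact Or.inr ⟨Z η, fun Y => interleave_odd Y Z η⟩

end Interleave

/-! ### Storing a symbol in the finite part of a state. -/

section Code

variable {S : Type v} [Fintype S]

/-- Numbers for the symbols. -/
noncomputable def symCode (s : Option S) : ℕ := (Fintype.equivFin (Option S) s).val

/-- The symbol with a given number. -/
noncomputable def symDecode (n : ℕ) : Option S := Function.invFun symCode n

theorem symCode_injective : Function.Injective (symCode (S := S)) :=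
  Fin.val_injective.comp (Fintype.equivFin _).injective

theorem symDecode_symCode (s : Option S) : symDecode (symCode s) = s :=
  Function.leftInverse_invFun symCode_injective s

theorem symCode_lt (s : Option S) : symCode s < Fintype.card (Option S) :=
  (Fintype.equivFin (Option S) s).isLt

end Code

/-! ### Duplicating the even track into the odd track. -/

section Copy

variable {S : Type v} [Fintype S] [LinearOrder (Option S)]

/-- The tape `v` with the contents of the first `η` even cells copied into the odd cells. -/
noncomputable def copied (v : Tape.{u} S) (η : Ordinal.{u}) : Tape.{u} S :=
  open Classical in
  interleave (fun ξ => v (2 * ξ)) fun ξ => if ξ < η then v (2 * ξ) else v (2 * ξ + 1)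

theorem copied_even {S : Type v} (v : Tape.{u} S) (η ξ : Ordinal.{u}) :
    copied v η (2 * ξ) = v (2 * ξ) :=
  interleave_even _ _ _

theorem copied_odd {S : Type v} (v : Tape.{u} S) (η ξ : Ordinal.{u}) [Decidable (ξ < η)] :
    copied v η (2 * ξ + 1) = if ξ < η then v (2 * ξ) else v (2 * ξ + 1) := by
  rw [copied, interleave_odd]
  congr

theorem copied_add_one {S : Type v} (v : Tape.{u} S) (η : Ordinal.{u}) :
    copied v (η + 1) = Function.update (copied v η) (2 * η + 1) (v (2 * η)) := by
  classical
  funext c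
  obtain ⟨ξ, rfl | rfl⟩ := exists_eq_two_mul c
  · rw [Function.update_of_ne (two_mul_ne_two_mul_add_one ξ η), copied_even, copied_even]
  · by_cases h : ξ = η
    · subst h
      rw [copied_odd, if_pos (lt_add_one ξ), Function.update_self]
    · have h' : 2 * ξ + 1 ≠ 2 * η + 1 := fun h' => h (two_mul_inj.1 (by simpa using h'))
      rw [Function.update_of_ne h', copied_odd, copied_odd]
      simp only [lt_add_one_iff, le_iff_lt_or_eq, h, or_false]

/-- Copying the even cells of a word into the odd cells. -/
theorem computation_copy {r : Program.{u} S} {s₀ : Snapshot.{u} S} {T x N : Ordinal.{u}}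
    {v w : Tape.{u} S} (hx : 1 ≤ x)
    (hr1 : ∀ s, r.toFun (ω * x, some s) =
      some (ω * x + (symCode (some s) + 1 : ℕ), some s, Motion.right))
    (hr2 : ∀ n : ℕ, ∀ s, r.toFun (ω * x + (n + 1 : ℕ), s) = some (ω * x, symDecode n, Motion.right))
    (hr3 : r.toFun (ω * x, none) = some (ω * (x + 1), none, Motion.stay))
    (hvw : ∀ η, v (2 * η) = w η) (hN : ∀ η, (w η).isSome ↔ η < N)
    (hv : ∀ c, 2 * N ≤ c → v c = none)
    (h0 : computation r s₀ T = ⟨v, ω * x, 0⟩) (hh : RunsBelow r s₀ T (ω * x)) :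
    ∃ T' h, computation r s₀ T' = ⟨interleave w w, ω * (x + 1), h⟩ ∧
      RunsBelow r s₀ T' (ω * (x + 1)) := by
  classical
  have hw : ∀ η, N ≤ η → w η = none := fun η h => by
    simpa using (not_congr (hN η)).2 h.not_gt
  have hstep1 : ∀ η < N, step r ⟨copied v η, ω * x, 2 * η⟩ =
      ⟨copied v η, ω * x + (symCode (w η) + 1 : ℕ), 2 * η + 1⟩ := by
    intro η hη
    obtain ⟨s, hs⟩ := Option.isSome_iff_exists.1 ((hN η).2 hη)
    have hread : copied v η (2 * η) = some s := by rw [copied_even, hvw, hs]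
    rw [step_keep hread (hr1 s), hs, move_right]
  have hstep2 : ∀ η < N, (step r)^[2] ⟨copied v η, ω * x, 2 * η⟩ =
      ⟨copied v (η + 1), ω * x, 2 * (η + 1)⟩ := by
    intro η hη
    rw [Function.iterate_succ_apply', Function.iterate_one, hstep1 η hη,
      step_write rfl (hr2 (symCode (w η)) _), copied_add_one, symDecode_symCode, hvw, move_right,
      mul_add_one, add_assoc, one_add_one_eq_two]
  have hwalk := computation_walk (r := r) (s₀ := s₀) (T := T) (N := N) (L := ω * x)
    (L' := ω * (x + 1)) (K := 2) (Y := copied v) (pos := fun η => 2 * η) two_pos ?_ hstep2 ?_ ?_ ?_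
    ?_ hh (omega_mul_lt (lt_add_one x)) (one_lt_omega_mul hx)
  · obtain ⟨h1, h2, -⟩ := hwalk
    -- Odd cells beyond the copied part agree with `w` as well, both being empty there.
    have hend : copied v N = interleave w w := by
      refine eq_interleave (fun η => by rw [copied_even, hvw]) fun η => ?_
      rw [copied_odd]
      split_ifs with h
      · exact hvw η
      · rw [hw η (not_lt.1 h), hv]
        refine le_trans ?_ le_self_add
        gcongr
        exact not_lt.1 h
    have hread : copied v N (2 * N) = none := by rw [copied_even, hv _ le_rfl]
    refine ⟨T + (2 : ℕ) * N + 1, 2 * N, ?_, h2.add_one ?_ ?_⟩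
    · rw [computation_add_one, h1, step_keep hread hr3, move_stay, hend]
    · rw [h1]; exact omega_mul_lt (lt_add_one x)
    · rw [h1]; exact (one_lt_omega_mul hx).ne'
  · rw [h0, mul_zero]
    congr 1
    funext c
    obtain ⟨ξ, rfl | rfl⟩ := exists_eq_two_mul c
    · rw [copied_even]
    · rw [copied_odd, if_neg not_lt_zero]
  · intro η hη j hj hj2
    obtain rfl : j = 1 := by omega
    rw [Function.iterate_one, hstep1 η hη]
    refine ⟨fun c => Or.inl rfl, ?_, omega_mul_add_lt (lt_add_one x) _⟩
    refine lt_add_of_pos_right _ ?_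
    exact_mod_cast Nat.succ_pos _
  · exact fun η => (isNormal_mul_right (a := (2 : Ordinal.{u})) two_pos).strictMono.le_apply
  · intro μ hμ
    -- Limits are multiples of `ω`, and `2 * ω = ω`; so the head arrives at the right even cell by
    -- the limit rule alone.
    have : 2 * μ = μ := by
      obtain ⟨ν, rfl⟩ := isSuccPrelimit_iff_omega0_dvd.1 hμ.isSuccPrelimit
      rw [← mul_assoc]
      congr 1
      exact mul_omega0 two_pos (natCast_lt_omega0 2)
    exact ⟨this, fun η hη => by
      conv_rhs => rw [← this]
      exact (isNormal_mul_right (a := (2 : Ordinal.{u})) two_pos).strictMono hη⟩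
  · intro μ _ hμ c
    obtain ⟨ξ, rfl | rfl⟩ := exists_eq_two_mul c
    · exact ⟨0, hμ.bot_lt, fun ζ _ _ => by rw [copied_even, copied_even]⟩
    · rcases lt_or_ge ξ μ with h | h
      · refine ⟨ξ + 1, hμ.add_one_lt h, fun ζ hζ _ => ?_⟩
        rw [copied_odd, copied_odd, if_pos h, if_pos (add_one_le_iff.1 hζ)]
      · refine ⟨0, hμ.bot_lt, fun ζ _ hζ => ?_⟩
        rw [copied_odd, copied_odd, if_neg h.not_gt, if_neg (hζ.le.trans h).not_gt]

end Copy

/-! ### Intermediate tapes of the compression. -/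

section Layout

/-- The finite remainder of an ordinal modulo `ω`. -/
noncomputable def finPart (o : Ordinal.{u}) : ℕ := (lt_omega0.1 (mod_lt o omega0_ne_zero)).choose

theorem finPart_omega_mul_add (a : Ordinal.{u}) (i : ℕ) : finPart (ω * a + i) = i := by
  have h : (finPart (ω * a + i) : Ordinal) = (ω * a + i) % ω :=
    (lt_omega0.1 (mod_lt (ω * a + (i : Ordinal)) omega0_ne_zero)).choose_spec.symm
  exact_mod_cast h.trans (omega_mul_add_mod a i)

theorem omega_mul_add_lt_iff {a b : Ordinal.{u}} {i j : ℕ} :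
    ω * a + i < ω * b + j ↔ a < b ∨ a = b ∧ i < j := by
  rcases lt_trichotomy a b with h | rfl | h
  · exact iff_of_true ((omega_mul_add_lt h i).trans_le le_self_add) (Or.inl h)
  · simp
  · refine iff_of_false ((omega_mul_add_lt h j).le.trans le_self_add).not_gt ?_
    rintro (h' | ⟨rfl, -⟩)
    · exact h.not_gt h'
    · exact lt_irrefl _ h

theorem omega_mul_add_le_iff {a b : Ordinal.{u}} {i j : ℕ} :
    ω * a + i ≤ ω * b + j ↔ a < b ∨ a = b ∧ i ≤ j := by
  rw [← not_lt, omega_mul_add_lt_iff]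
  rcases lt_trichotomy a b with h | rfl | h
  · simp [h, h.not_gt, h.ne']
  · simp
  · simp [h, h.not_gt, h.ne']

variable {S : Type v}

/-- The tape on which the symbols of `w` are moved towards their places in `k` passes: the symbol
number `ω * a + m` is in the cell `ω * a + max m (2 * m + 1 - k)`. -/
noncomputable def layout (k : ℕ) (w : Tape.{u} S) : Tape.{u} S := fun c =>
  if finPart c < k then w c
  else if (finPart c - k) % 2 = 1 then w (ω * (c / ω) + (k + (finPart c - k) / 2 : ℕ)) else none

theorem layout_apply (k : ℕ) (w : Tape.{u} S) (a : Ordinal.{u}) (i : ℕ) :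
    layout k w (ω * a + i) = if i < k then w (ω * a + i) else
      if (i - k) % 2 = 1 then w (ω * a + (k + (i - k) / 2 : ℕ)) else none := by
  rw [layout, finPart_omega_mul_add, omega_mul_add_div]

theorem layout_zero (w : Tape.{u} S) : layout 0 w = interleave (fun _ => none) w := by
  have h2 : (2 : Ordinal.{u}) * ω = ω := mul_omega0 two_pos (natCast_lt_omega0 2)
  refine eq_interleave (fun η => ?_) fun η => ?_ <;>
    obtain ⟨a, i, rfl⟩ := exists_eq_omega_mul_add η
  · have : 2 * (ω * a + (i : Ordinal)) = ω * a + (2 * i : ℕ) := by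
      rw [mul_add, ← mul_assoc, h2]; push_cast; rfl
    rw [this, layout_apply, if_neg (by omega), if_neg (by omega)]
  · have : 2 * (ω * a + (i : Ordinal)) + 1 = ω * a + (2 * i + 1 : ℕ) := by
      rw [mul_add, ← mul_assoc, h2, add_assoc]; push_cast; rfl
    rw [this, layout_apply, if_neg (by omega), if_pos (by omega)]
    congr 3
    omega

/-- The cell at which the `k`-th pass starts treating the symbol number `o`. -/
noncomputable def passPos (k : ℕ) (o : Ordinal.{u}) : Ordinal.{u} :=
  ω * (o / ω) + (max (finPart o) (2 * finPart o - k) : ℕ)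

theorem passPos_apply (k : ℕ) (a : Ordinal.{u}) (m : ℕ) :
    passPos k (ω * a + m) = ω * a + (max m (2 * m - k) : ℕ) := by
  rw [passPos, finPart_omega_mul_add, omega_mul_add_div]

theorem le_passPos (k : ℕ) (o : Ordinal.{u}) : o ≤ passPos k o := by
  obtain ⟨a, m, rfl⟩ := exists_eq_omega_mul_add o
  rw [passPos_apply, omega_mul_add_le_iff]
  exact Or.inr ⟨rfl, le_max_left _ _⟩

theorem passPos_limit (k : ℕ) {μ : Ordinal.{u}} (hμ : IsSuccLimit μ) :
    passPos k μ = μ ∧ ∀ η < μ, passPos k η < μ := by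
  obtain ⟨ν, rfl⟩ := isSuccPrelimit_iff_omega0_dvd.1 hμ.isSuccPrelimit
  constructor
  · simpa using passPos_apply k ν 0
  · intro η hη
    obtain ⟨a, m, rfl⟩ := exists_eq_omega_mul_add η
    rw [passPos_apply]
    refine omega_mul_add_lt ?_ _
    by_contra h
    exact ((omega_mul_le (not_lt.1 h)).trans le_self_add).not_gt hη

/-- From the cell where symbol number `N` would be treated, both the old and the new tape of the
pass are empty. Hence the head finds two empty cells in a row there, which it never does before the
end of the word. -/
theorem layout_eq_none {k k' : ℕ} (hk : k' = k ∨ k' = k + 1) {w : Tape.{u} S} {N c : Ordinal.{u}}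
    (hw : ∀ η, N ≤ η → w η = none) (hc : passPos k N ≤ c) : layout k' w c = none := by
  obtain ⟨a, m, rfl⟩ := exists_eq_omega_mul_add N
  obtain ⟨b, i, rfl⟩ := exists_eq_omega_mul_add c
  rw [passPos_apply, omega_mul_add_le_iff] at hc
  rw [layout_apply]
  split_ifs with h1 h2
  · refine hw _ (omega_mul_add_le_iff.2 (hc.imp_right fun h => ⟨h.1, ?_⟩))
    omega
  · refine hw _ (omega_mul_add_le_iff.2 (hc.imp_right fun h => ⟨h.1, ?_⟩))
    omega
  · rfl

/-- A cell with finite part `i` is final once more than `i` passes are counted; this makes the tapes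
converge cellwise. -/
theorem layout_eventually {k : ℕ} {c : Ordinal.{u}} (hk : finPart c < k) (w : Tape.{u} S) :
    layout k w c = w c := by
  rw [layout, if_pos hk]

open Classical in
/-- The tape during the `k`-th pass, before the symbol number `η` is treated. -/
noncomputable def passTape (k : ℕ) (w : Tape.{u} S) (η : Ordinal.{u}) : Tape.{u} S :=
  fun c => if c < passPos k η then layout (k + 1) w c else layout k w c

theorem passTape_of_lt {k : ℕ} {w : Tape.{u} S} {η c : Ordinal.{u}} (h : c < passPos k η) :
    passTape k w η c = layout (k + 1) w c := if_pos h

theorem passTape_of_le {k : ℕ} {w : Tape.{u} S} {η c : Ordinal.{u}} (h : passPos k η ≤ c) :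
    passTape k w η c = layout k w c := if_neg h.not_gt

theorem passTape_mem (k : ℕ) (w : Tape.{u} S) (η c : Ordinal.{u}) :
    passTape k w η c = layout k w c ∨ passTape k w η c = layout (k + 1) w c :=
  (lt_or_ge c (passPos k η)).symm.imp passTape_of_le passTape_of_lt

/-- The symbol number `η` is in its final place already. -/
theorem passTape_settled {k m : ℕ} (h : m < k) (w : Tape.{u} S) (a : Ordinal.{u}) :
    passPos k (ω * a + m) = ω * a + m ∧ passPos k (ω * a + m + 1) = ω * a + m + 1 ∧
      passTape k w (ω * a + m) (ω * a + m) = w (ω * a + m) ∧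
      passTape k w (ω * a + m + 1) = passTape k w (ω * a + m) := by
  have h1 : passPos k (ω * a + (m : Ordinal)) = ω * a + m := by
    rw [passPos_apply]; congr 2; omega
  have h2 : passPos k (ω * a + (m : Ordinal) + 1) = ω * a + m + 1 := by
    rw [add_assoc, ← Nat.cast_succ, passPos_apply]; congr 2; omega
  have h3 : ∀ k', m < k' → layout k' w (ω * a + m) = w (ω * a + m) := fun k' hk => by
    rw [layout_apply, if_pos hk]
  refine ⟨h1, h2, ?_, ?_⟩
  · rw [passTape_of_le h1.le, h3 k h]
  · funext c
    rcases lt_trichotomy c (ω * a + m) with hc | rfl | hc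
    · rw [passTape_of_lt (η := ω * a + m) (by rw [h1]; exact hc),
        passTape_of_lt (η := ω * a + m + 1) (by rw [h2]; exact hc.trans (lt_add_one _))]
    · rw [passTape_of_le h1.le, passTape_of_lt (by rw [h2]; exact lt_add_one _), h3 k h,
        h3 (k + 1) (by omega)]
    · rw [passTape_of_le (by rw [h2]; exact add_one_le_iff.2 hc),
        passTape_of_le (by rw [h1]; exact hc.le)]

/-- The symbol number `η` is to be moved by one cell. -/
theorem passTape_moved {k m : ℕ} (h : k ≤ m) (w : Tape.{u} S) (a : Ordinal.{u}) :
    passPos k (ω * a + m + 1) = passPos k (ω * a + m) + 1 + 1 ∧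
      passTape k w (ω * a + m) (passPos k (ω * a + m)) = none ∧
      passTape k w (ω * a + m) (passPos k (ω * a + m) + 1) = w (ω * a + m) ∧
      passTape k w (ω * a + m + 1) (passPos k (ω * a + m) + 1) = none ∧
      passTape k w (ω * a + m + 1) =
        Function.update (Function.update (passTape k w (ω * a + m))
          (passPos k (ω * a + m) + 1) none) (passPos k (ω * a + m)) (w (ω * a + m)) := by
  have h1 : passPos k (ω * a + (m : Ordinal)) = ω * a + (2 * m - k : ℕ) := by
    rw [passPos_apply]; congr 2; omega
  have h1' : passPos k (ω * a + (m : Ordinal)) + 1 = ω * a + (2 * m - k + 1 : ℕ) := by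
    rw [h1, add_assoc, ← Nat.cast_succ]
  have h2 : passPos k (ω * a + (m : Ordinal) + 1) = passPos k (ω * a + m) + 1 + 1 := by
    rw [h1', add_assoc, ← Nat.cast_succ, passPos_apply, add_assoc, ← Nat.cast_succ]
    congr 2; omega
  have hnew : passTape k w (ω * a + m + 1) (passPos k (ω * a + m) + 1) = none := by
    rw [passTape_of_lt (by rw [h2]; exact lt_add_one _), h1', layout_apply,
      if_neg (by omega), if_neg (by omega)]
  have hlt : passPos k (ω * a + (m : Ordinal)) < passPos k (ω * a + m + 1) := by
    rw [h2]; exact (lt_add_one _).trans (lt_add_one _)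
  refine ⟨h2, ?_, ?_, hnew, ?_⟩
  · rw [passTape_of_le le_rfl, h1, layout_apply, if_neg (by omega), if_neg (by omega)]
  · rw [passTape_of_le (lt_add_one _).le, h1', layout_apply, if_neg (by omega),
      if_pos (by omega)]
    congr 3; omega
  · funext c
    by_cases hc : c = passPos k (ω * a + m)
    · subst hc
      rw [Function.update_self, passTape_of_lt hlt, h1, layout_apply]
      split_ifs with h3 h4
      · congr 3; omega
      · congr 3; omega
      · omega
    rw [Function.update_of_ne hc]
    by_cases hc' : c = passPos k (ω * a + m) + 1
    · subst hc'
      rw [Function.update_self, hnew]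
    rw [Function.update_of_ne hc']
    rcases lt_or_ge c (passPos k (ω * a + m)) with h3 | h3
    · rw [passTape_of_lt h3, passTape_of_lt (h3.trans hlt)]
    · rw [passTape_of_le h3, passTape_of_le]
      rw [h2]
      have h4 := add_one_le_iff.2 (h3.lt_of_ne' hc)
      exact add_one_le_iff.2 (h4.lt_of_ne' hc')

end Layout

/-! ### One pass, and the limit of `ω` passes. -/

section Pass

variable {S : Type v} [Fintype S] [LinearOrder (Option S)]

/-- The rule for a pass: symbols following an empty cell are moved into that cell, until two empty
cells are found. Then the states increase through `ω` many values. -/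
noncomputable def passRule (S : Type v) [Fintype S] : ℕ → Option S → ℕ × Option S × Motion
  | 0, none => (1, none, .right)
  | 0, some s => (3, some s, .stay)
  | 1, none => (5 + Fintype.card (Option S), none, .stay)
  | 1, some s => (5 + symCode (some s), none, .left)
  | 2, s => (0, s, .right)
  | 3, s => (4, s, .stay)
  | 4, s => (2, s, .stay)
  | j + 5, s => if j < Fintype.card (Option S) then (2, symDecode j, .right) else (j + 6, s, .stay)

theorem passRule_move {S : Type v} [Fintype S] (s s' : Option S) :
    passRule S (5 + symCode s) s' = (2, s, .right) := by
  rw [add_comm]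
  simp only [passRule]
  rw [if_pos (symCode_lt s), symDecode_symCode]

theorem passRule_jump {S : Type v} [Fintype S] {j : ℕ} (hj : 5 + Fintype.card (Option S) ≤ j) (s : Option S) :
    passRule S j s = (j + 1, s, .stay) := by
  obtain ⟨i, rfl⟩ := Nat.exists_eq_add_of_le hj
  rw [show 5 + Fintype.card (Option S) + i = (Fintype.card (Option S) + i) + 5 by omega]
  simp only [passRule]
  rw [if_neg (by omega)]

/-- A pass moves all symbols that are not yet in their place by one cell, and brings the head back
to the cell `0`. -/
theorem computation_pass {r : Program.{u} S} {s₀ : Snapshot.{u} S} {T x N : Ordinal.{u}} {k : ℕ}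
    {w : Tape.{u} S} (hx : 1 ≤ x)
    (hr : ∀ j : ℕ, ∀ s, r.toFun (ω * x + j, s) =
      some (ω * x + (passRule S j s).1, (passRule S j s).2))
    (hN : ∀ η, (w η).isSome ↔ η < N)
    (h0 : computation r s₀ T = ⟨layout k w, ω * x, 0⟩) (hh : RunsBelow r s₀ T (ω * x)) :
    ∃ T', T < T' ∧ computation r s₀ T' = ⟨layout (k + 1) w, ω * (x + 1), 0⟩ ∧
      RunsBelow r s₀ T' (ω * (x + 1)) ∧
      ∀ t, T ≤ t → t < T' → ω * x ≤ (computation r s₀ t).state ∧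
        ∀ c, (computation r s₀ t).tape c = layout k w c ∨
          (computation r s₀ t).tape c = layout (k + 1) w c := by
  have hx1 : 1 < ω * x := one_lt_omega_mul hx
  have hlt : ∀ j : ℕ, ω * x + j < ω * (x + 1) := omega_mul_add_lt (lt_add_one x)
  have hw : ∀ η, N ≤ η → w η = none := fun η h => by
    simpa using (not_congr (hN η)).2 h.not_gt
  have hr0 : ∀ s, r.toFun (ω * x, s) = some (ω * x + (passRule S 0 s).1, (passRule S 0 s).2) :=
    fun s => by simpa using hr 0 s
  set Y := passTape k w with hY
  set pos : Ordinal.{u} → Ordinal.{u} := passPos k with hpos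
  -- The detour through the states 3 and 4 makes a settled symbol cost four steps, exactly like a
  -- moved one, so that the walk has the uniform period `K = 4`.
  have hsteps : ∀ η < N, ∃ s1 s2 s3 : Snapshot.{u} S,
      step r ⟨Y η, ω * x, pos η⟩ = s1 ∧ step r s1 = s2 ∧ step r s2 = s3 ∧
      step r s3 = ⟨Y (η + 1), ω * x, pos (η + 1)⟩ ∧
      ∀ s ∈ [s1, s2, s3], (∀ c, s.tape c = Y η c ∨ s.tape c = Y (η + 1) c) ∧
        ∃ j : ℕ, 0 < j ∧ s.state = ω * x + j := by
    intro η hη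
    obtain ⟨s, hs⟩ := Option.isSome_iff_exists.1 ((hN η).2 hη)
    obtain ⟨a, m, rfl⟩ := exists_eq_omega_mul_add η
    rcases lt_or_ge m k with hm | hm
    · obtain ⟨h1, h2, h3, h4⟩ := passTape_settled hm w a
      rw [hs] at h3
      refine ⟨⟨Y (ω * a + m), ω * x + (3 : ℕ), pos (ω * a + m)⟩,
        ⟨Y (ω * a + m), ω * x + (4 : ℕ), pos (ω * a + m)⟩,
        ⟨Y (ω * a + m), ω * x + (2 : ℕ), pos (ω * a + m)⟩, ?_, ?_, ?_, ?_, ?_⟩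
      · exact step_keep (by rw [hpos, h1]; exact h3) (hr0 (some s))
      · exact step_keep rfl (hr 3 _)
      · exact step_keep rfl (hr 4 _)
      · rw [step_keep rfl (hr 2 _), hY, h4, hpos, h2, h1]
        simp [passRule, move_right]
      · intro t ht
        simp only [List.mem_cons, List.not_mem_nil, or_false] at ht
        rcases ht with rfl | rfl | rfl
        · exact ⟨fun c => Or.inl rfl, 3, by omega, rfl⟩
        · exact ⟨fun c => Or.inl rfl, 4, by omega, rfl⟩
        · exact ⟨fun c => Or.inl rfl, 2, by omega, rfl⟩
    · obtain ⟨h1, h2, h3, h4, h5⟩ := passTape_moved hm w a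
      rw [hs] at h3 h5
      refine ⟨⟨Y (ω * a + m), ω * x + (1 : ℕ), pos (ω * a + m) + 1⟩,
        ⟨Function.update (Y (ω * a + m)) (pos (ω * a + m) + 1) none,
          ω * x + (5 + symCode (some s) : ℕ), pos (ω * a + m)⟩,
        ⟨Y (ω * a + m + 1), ω * x + (2 : ℕ), pos (ω * a + m) + 1⟩, ?_, ?_, ?_, ?_, ?_⟩
      · exact step_keep h2 (hr0 none)
      · rw [step_write h3 (hr 1 (some s)), move_left_add_one]
        rfl
      · have := hr (5 + symCode (some s))
        simp only [passRule_move] at this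
        rw [step_write rfl (this _), hY, h5]
        rfl
      · rw [step_keep rfl (hr 2 _), hpos, h1]
        simp [passRule, move_right]
      · intro t ht
        simp only [List.mem_cons, List.not_mem_nil, or_false] at ht
        rcases ht with rfl | rfl | rfl
        · exact ⟨fun c => Or.inl rfl, 1, by omega, rfl⟩
        -- With the symbol erased but not yet rewritten, the erased cell already has its content in
        -- the next tape, namely empty.
        · refine ⟨fun c => ?_, _, by omega, rfl⟩
          by_cases hc : c = pos (ω * a + m) + 1
          · subst hc
            refine Or.inr ?_
            simp only [Function.update_self]
            exact h4.symm
          · exact Or.inl (Function.update_of_ne hc _ _)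
        · exact ⟨fun c => Or.inr rfl, 2, by omega, rfl⟩
  have hwalk := computation_walk (r := r) (s₀ := s₀) (T := T) (N := N) (L := ω * x)
    (L' := ω * (x + 1)) (K := 4) (Y := Y) (pos := pos) (by norm_num) ?_ ?_ ?_
    (le_passPos k) (fun μ hμ => passPos_limit k hμ) ?_ hh (omega_mul_lt (lt_add_one x)) hx1
  · obtain ⟨h1, h2, h3⟩ := hwalk
    have hYN : Y N = layout (k + 1) w := by
      funext c
      rcases lt_or_ge c (passPos k N) with h | h
      · exact passTape_of_lt h
      · rw [hY, passTape_of_le h, layout_eq_none (Or.inl rfl) hw h,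
          layout_eq_none (Or.inr rfl) hw h]
    have hnone : ∀ c, pos N ≤ c → Y N c = none := fun c hc => by
      rw [hYN, layout_eq_none (Or.inr rfl) hw hc]
    set T₁ := T + (4 : ℕ) * N with hT₁
    -- After the walk two empty cells are read. The index `5 + Fintype.card (Option S)` lies just
    -- above those that store symbols, so the states increase from there and the head is reset.
    have e1 : computation r s₀ (T₁ + 1) = ⟨Y N, ω * x + (1 : ℕ), pos N + 1⟩ := by
      rw [computation_add_one, h1]
      exact step_keep (hnone _ le_rfl) (hr0 none)
    have e2 : computation r s₀ (T₁ + 1 + 1) =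
        ⟨Y N, ω * x + (5 + Fintype.card (Option S) : ℕ), pos N + 1⟩ := by
      rw [computation_add_one, e1]
      exact step_keep (hnone _ (lt_add_one _).le) (hr 1 none)
    have r1 : RunsBelow r s₀ (T₁ + 1) (ω * (x + 1)) :=
      h2.add_one (by rw [h1]; exact omega_mul_lt (lt_add_one x)) (by rw [h1]; exact hx1.ne')
    have r2 : RunsBelow r s₀ (T₁ + 1 + 1) (ω * (x + 1)) :=
      r1.add_one (by rw [e1]; exact hlt 1) (by rw [e1]; exact (hx1.trans_le le_self_add).ne')
    obtain ⟨e3, r3, h4⟩ := computation_jump hx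
      (fun j hj s => by rw [hr, passRule_jump hj]) e2 r2
    rw [hYN] at e3
    refine ⟨_, ?_, e3, r3, ?_⟩
    · calc T ≤ T₁ := le_self_add
        _ < T₁ + 1 := lt_add_one _
        _ ≤ T₁ + 1 + 1 := le_self_add
        _ ≤ _ := le_self_add
    · intro t ht1 ht2
      rcases lt_or_ge t T₁ with ht | ht
      · obtain ⟨h5, η, -, h6⟩ := h3 t ht1 ht
        refine ⟨h5, fun c => ?_⟩
        rcases h6 c with h7 | h7
        · rw [h7]; exact passTape_mem k w η c
        · rw [h7]; exact passTape_mem k w (η + 1) c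
      rcases lt_or_ge t (T₁ + 1) with ht' | ht'
      · obtain rfl : t = T₁ := le_antisymm (lt_add_one_iff.1 ht') ht
        rw [h1]
        exact ⟨le_rfl, fun c => passTape_mem k w N c⟩
      rcases lt_or_ge t (T₁ + 1 + 1) with ht'' | ht''
      · obtain rfl : t = T₁ + 1 := le_antisymm (lt_add_one_iff.1 ht'') ht'
        rw [e1]
        exact ⟨le_self_add, fun c => passTape_mem k w N c⟩
      · obtain ⟨h5, h6⟩ := h4 t ht'' ht2
        rw [h6]
        exact ⟨h5, fun c => passTape_mem k w N c⟩
  · have hp0 : pos 0 = 0 := by simpa using passPos_apply k 0 0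
    rw [h0, hp0]
    congr 1
    funext c
    exact (passTape_of_le (show passPos k 0 ≤ c from hp0.le.trans zero_le)).symm
  · intro η hη
    obtain ⟨s1, s2, s3, h1, h2, h3, h4, -⟩ := hsteps η hη
    rw [Function.iterate_succ_apply, h1, Function.iterate_succ_apply, h2,
      Function.iterate_succ_apply, h3, Function.iterate_one, h4]
  · intro η hη j hj hj4
    obtain ⟨s1, s2, s3, h1, h2, h3, h4, h5⟩ := hsteps η hη
    have hmem : (step r)^[j] ⟨Y η, ω * x, pos η⟩ ∈ [s1, s2, s3] := by
      rcases (by omega : j = 1 ∨ j = 2 ∨ j = 3) with rfl | rfl | rfl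
      · rw [Function.iterate_one, h1]; simp
      · rw [Function.iterate_succ_apply, h1, Function.iterate_one, h2]; simp
      · rw [Function.iterate_succ_apply, h1, Function.iterate_succ_apply, h2,
          Function.iterate_one, h3]
        simp
    obtain ⟨h6, i, hi, h7⟩ := h5 _ hmem
    refine ⟨h6, ?_, ?_⟩
    · rw [h7]
      exact lt_add_of_pos_right _ (by exact_mod_cast hi)
    · rw [h7]; exact hlt i
  -- Below `μ` a cell takes its new content once the walk has passed it; from `μ` on it still has
  -- its old one.
  · intro μ _ hμ c
    rcases lt_or_ge c μ with h | h
    · refine ⟨c + 1, hμ.add_one_lt h, fun ζ hζ hζμ => ?_⟩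
      rw [hY, passTape_of_lt ((add_one_le_iff.1 hζ).trans_le (le_passPos k ζ)),
        passTape_of_lt (h.trans_le (le_passPos k μ))]
    · refine ⟨0, hμ.bot_lt, fun ζ _ hζ => ?_⟩
      rw [hY, passTape_of_le (((passPos_limit k hμ).2 ζ hζ).le.trans h),
        passTape_of_le ((passPos_limit k hμ).1.le.trans h)]

/-- After `ω` many passes, every symbol is in its place. -/
theorem computation_compress {r : Program.{u} S} {s₀ : Snapshot.{u} S} {T x N : Ordinal.{u}}
    {w : Tape.{u} S} (hx : 1 ≤ x)
    (hr : ∀ k j : ℕ, ∀ s, r.toFun (ω * (x + k) + j, s) =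
      some (ω * (x + k) + (passRule S j s).1, (passRule S j s).2))
    (hN : ∀ η, (w η).isSome ↔ η < N)
    (h0 : computation r s₀ T = ⟨layout 0 w, ω * x, 0⟩) (hh : RunsBelow r s₀ T (ω * x)) :
    ∃ T', computation r s₀ T' = ⟨w, ω * (x + ω), 0⟩ ∧ RunsBelow r s₀ T' (ω * (x + ω)) := by
  have hpass := fun (k : ℕ) (T : Ordinal.{u})
    (h : computation r s₀ T = ⟨layout k w, ω * (x + k), 0⟩ ∧ RunsBelow r s₀ T (ω * (x + k))) =>
      computation_pass (hx.trans le_self_add) (hr k) hN h.1 h.2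
  choose! f hf1 hf2 hf3 hf4 using hpass
  -- `τ k` is the starting time of pass number `k`; the supremum of these times is where the limit
  -- rule is applied.
  let τ : ℕ → Ordinal.{u} := fun k => Nat.rec T f k
  have hτ : ∀ k : ℕ, computation r s₀ (τ k) = ⟨layout k w, ω * (x + k), 0⟩ ∧
      RunsBelow r s₀ (τ k) (ω * (x + k)) := by
    intro k
    induction k with
    | zero => simpa using ⟨h0, hh⟩
    | succ k ih =>
      rw [Nat.cast_succ, ← add_assoc]
      exact ⟨hf2 k _ ih, hf3 k _ ih⟩
  have hmono : StrictMono τ := strictMono_nat_of_lt_succ fun k => hf1 k _ (hτ k)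
  have hbdd : BddAbove (Set.range τ) := bddAbove_of_small
  have hsup : ∀ t, t < ⨆ k, τ k ↔ ∃ k, t < τ k := fun t => lt_ciSup_iff hbdd
  have hlim : IsSuccLimit (⨆ k, τ k) := by
    refine ⟨fun h => ?_, isSuccPrelimit_of_succ_lt fun a ha => ?_⟩
    · exact (h.not_lt) ((hsup _).2 ⟨1, hmono Nat.zero_lt_one⟩)
    · obtain ⟨k, hk⟩ := (hsup a).1 ha
      exact (hsup _).2 ⟨k + 1, (succ_le_of_lt hk).trans_lt (hmono (Nat.lt_succ_self k))⟩
  -- Each time from `τ k₀` on falls into some pass `k ≥ k₀`, found as the predecessor of the least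
  -- `n` with `t < τ n`.
  have hint : ∀ t, t < ⨆ k, τ k → ∀ k₀, τ k₀ ≤ t → ∃ k, k₀ ≤ k ∧
      ω * (x + k) ≤ (computation r s₀ t).state ∧
      ∀ c, (computation r s₀ t).tape c = layout k w c ∨
        (computation r s₀ t).tape c = layout (k + 1) w c := by
    intro t ht k₀ hk₀
    have hn : t < τ (sInf {k | t < τ k}) := Nat.sInf_mem (s := {k | t < τ k}) ((hsup t).1 ht)
    have hmin : ∀ k < sInf {k | t < τ k}, ¬ t < τ k := fun k hk => Nat.notMem_of_lt_sInf hk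
    generalize sInf {k | t < τ k} = n at hn hmin
    have hk₀n : k₀ < n := hmono.lt_iff_lt.1 (hk₀.trans_lt hn)
    obtain ⟨k, hk⟩ : ∃ k, n = k + 1 := Nat.exists_eq_succ_of_ne_zero (by omega)
    have hk1 : τ k ≤ t := not_lt.1 (hmin k (by omega))
    rw [hk] at hn
    exact ⟨k, by omega, hf4 k _ (hτ k) t hk1 hn⟩
  have hrun : RunsBelow r s₀ (⨆ k, τ k) (ω * (x + ω)) := by
    intro t ht
    obtain ⟨k, hk⟩ := (hsup t).1 ht
    refine (hτ k).2.mono ?_ t hk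
    have := (natCast_lt_omega0 k).le
    gcongr
  refine ⟨⨆ k, τ k, ?_, hrun⟩
  rw [computation_limit _ _ hlim]
  refine limitSnapshot_of_fresh (fun ξ => (hrun ξ.1 ξ.2).1) ?_ ?_
  · intro b hb
    have hnorm : IsNormal fun o : Ordinal.{u} => ω * (x + o) :=
      (isNormal_mul_right omega0_pos).comp (isNormal_add_right x)
    obtain ⟨o, ho, hbo⟩ := (hnorm.lt_iff_exists_lt isSuccLimit_omega0).1 hb
    obtain ⟨k₀, rfl⟩ := lt_omega0.1 ho
    refine ⟨⟨τ k₀, (hsup _).2 ⟨k₀ + 1, hmono (Nat.lt_succ_self _)⟩⟩, fun ζ hζ => ?_⟩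
    obtain ⟨k, hk, h1, -⟩ := hint ζ.1 ζ.2 k₀ hζ
    refine hbo.trans_le (le_trans ?_ h1)
    gcongr
  · intro c
    refine ⟨⟨τ (finPart c + 1), (hsup _).2 ⟨finPart c + 1 + 1, hmono (Nat.lt_succ_self _)⟩⟩,
      fun ζ hζ => ?_⟩
    obtain ⟨k, hk, -, h1⟩ := hint ζ.1 ζ.2 (finPart c + 1) hζ
    rcases h1 c with h2 | h2
    · rw [h2, layout_eventually (by omega)]
    · rw [h2, layout_eventually (by omega)]

end Pass

/-! ### Programs given by a rule on an initial segment of the states. -/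

section OfRule

variable {S : Type v} [Fintype S]

open Classical in
/-- The program with the given rule for the states below `b`. -/
noncomputable def Program.ofRule (b : Ordinal.{u})
    (f : Ordinal.{u} → Option S → Ordinal.{u} × Option S × Motion) : Program.{u} S where
  toFun q := if q.1 < b then some (f q.1 q.2) else none
  small_dom := by
    have h : ∀ q : {q : Ordinal.{u} × Option S // (if q.1 < b then some (f q.1 q.2) else none).isSome},
        q.1.1 < b := fun q => by
      by_contra h'
      have := q.2
      rw [if_neg h'] at this
      simp at this
    have : Small.{u} (Set.Iio b × Option S) := inferInstance
    refine small_of_injective (β := Set.Iio b × Option S) (f := fun q => (⟨q.1.1, h q⟩, q.1.2)) ?_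
    intro q q' hq
    simp only [Prod.mk.injEq] at hq
    exact Subtype.ext (Prod.ext (congrArg Subtype.val hq.1) hq.2)

theorem Program.ofRule_apply {b : Ordinal.{u}}
    {f : Ordinal.{u} → Option S → Ordinal.{u} × Option S × Motion} {o : Ordinal.{u}} (ho : o < b)
    (s : Option S) : (Program.ofRule b f).toFun (o, s) = some (f o s) := if_pos ho

end OfRule

/-! ### The class of all words is semidecidable. -/

section Erase

variable {S : Type v} [Fintype S] [LinearOrder (Option S)]

open Classical in
/-- The program that replaces every word by the word of length one with entry `a`. -/
noncomputable def eraseProgram (a : S) : Program.{u} S :=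
  Program.ofRule 3 fun o s =>
    if o = 0 then (2, some a, .right)
    else if s = none then (1, none, .stay) else (2, none, .right)

theorem interp_eraseProgram (a : S) {w : Tape.{u} S} {ξ : Ordinal.{u}}
    (hw : ∀ η, (w η).isSome ↔ η < ξ) :
    interp (eraseProgram a) w = Part.some (ordTape a 0) := by
  classical
  have h13 : (2 : Ordinal.{u}) < 3 := by exact_mod_cast (by norm_num : 2 < 3)
  have hr0 : ∀ s, (eraseProgram a).toFun (0, s) = some ((2 : Ordinal.{u}), some a, .right) :=
    fun s => by
      rw [eraseProgram, Program.ofRule_apply (two_pos.trans h13), if_pos rfl]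
  have hr2 : ∀ s, (eraseProgram a).toFun (2, some s) =
      some ((2 : Ordinal.{u}), none, .right) := fun s => by
    rw [eraseProgram, Program.ofRule_apply h13, if_neg two_ne_zero, if_neg (by simp)]
  have hr2' : (eraseProgram a).toFun (2, none) = some ((1 : Ordinal.{u}), none, .stay) := by
    rw [eraseProgram, Program.ofRule_apply h13, if_neg two_ne_zero, if_pos rfl]
  have hnone : ∀ η, ξ ≤ η → w η = none := fun η h => by
    simpa using (not_congr (hw η)).2 h.not_gt
  have hpos : ∀ η : Ordinal.{u}, 1 + η ≠ 0 := fun η => (zero_lt_one.trans_le le_self_add).ne'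
  set Y : Ordinal.{u} → Tape.{u} S := fun η c =>
    if c = 0 then some a else if c < 1 + η then none else w c with hY
  have h0 : computation (eraseProgram a) ⟨w, 0, 0⟩ 0 = ⟨w, 0, 0⟩ := computation_zero _ _
  have h1 : computation (eraseProgram a) ⟨w, 0, 0⟩ 1 = ⟨Y 0, 2, 1 + 0⟩ := by
    rw [← zero_add (1 : Ordinal.{u}), computation_add_one, h0, step_write rfl (hr0 _), move_right]
    congr 1
    · funext c
      by_cases hc : c = 0
      · simp [hY, hc]
      · rw [Function.update_of_ne hc]
        simp [hY, hc]
    · simp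
  have hrun0 : RunsBelow (eraseProgram a) ⟨w, 0, 0⟩ 1 2 := by
    intro t ht
    rw [lt_one_iff] at ht
    subst ht
    rw [h0]
    exact ⟨two_pos, zero_ne_one⟩
  -- Cell 0 is treated separately, so the walk erases the cells `1 + η` with `η < ξ - 1`.
  -- Subtraction is on the left, so these are the cells `c` with `1 ≤ c < ξ`; there are none if `ξ ≤
  -- 1`.
  have hwalk := computation_walk (r := eraseProgram a) (s₀ := ⟨w, 0, 0⟩) (T := 1) (N := ξ - 1)
    (L := 2) (L' := 3) (K := 1) (Y := Y) (pos := fun η => 1 + η) one_pos h1 ?_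
    (fun η _ j hj hj1 => by omega) (fun η => le_add_self) ?_ ?_ hrun0 h13 one_lt_two
  · obtain ⟨e1, r1, -⟩ := hwalk
    have hend : ∀ c, 1 + (ξ - 1) ≤ c → w c = none := fun c hc =>
      hnone c ((le_add_sub ξ 1).trans hc)
    have hread : Y (ξ - 1) (1 + (ξ - 1)) = none := by
      simp only [hY]
      rw [if_neg (hpos _), if_neg (lt_irrefl _), hend _ le_rfl]
    have e2 := (computation_add_one (eraseProgram a) ⟨w, 0, 0⟩ _).trans
      ((congrArg _ e1).trans (step_keep hread hr2'))
    have r2 := r1.add_one (by rw [e1]; exact h13) (by rw [e1]; exact one_lt_two.ne')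
    rw [interp_eq_some e2 rfl r2]
    congr 1
    funext c
    simp only [hY, ordTape]
    split_ifs with h2 h3
    · rfl
    · rfl
    · exact hend c (not_lt.1 h3)
  · intro η hη
    have hlt : 1 + η < ξ := lt_sub.1 hη
    obtain ⟨s, hs⟩ := Option.isSome_iff_exists.1 ((hw _).2 hlt)
    have hread : Y η (1 + η) = some s := by
      simp only [hY]
      rw [if_neg (hpos _), if_neg (lt_irrefl _), hs]
    rw [Function.iterate_one, step_write hread (hr2 s), move_right, add_assoc]
    congr 1
    funext c
    by_cases hc : c = 1 + η
    · subst hc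
      rw [Function.update_self]
      simp only [hY]
      rw [if_neg (hpos _), if_pos (by rw [← add_assoc]; exact lt_add_one _)]
    · rw [Function.update_of_ne hc]
      simp only [hY, ← add_assoc, lt_add_one_iff, le_iff_lt_or_eq, hc, or_false]
  · intro μ hμ
    have : 1 + μ = μ := one_add_of_omega0_le (omega0_le_of_isSuccLimit hμ)
    exact ⟨this, fun η hη => by
      conv_rhs => rw [← this]
      rwa [add_lt_add_iff_left]⟩
  · intro μ _ hμ c
    have hμ1 : 1 + μ = μ := one_add_of_omega0_le (omega0_le_of_isSuccLimit hμ)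
    rcases lt_or_ge c μ with h | h
    · refine ⟨c + 1, hμ.add_one_lt h, fun ζ hζ _ => ?_⟩
      have h2 : c < 1 + ζ := (add_one_le_iff.1 hζ).trans_le le_add_self
      have h3 : c < 1 + μ := h.trans_le le_add_self
      simp only [hY, h2, h3, if_true]
    · refine ⟨0, hμ.bot_lt, fun ζ _ hζ => ?_⟩
      have h3 : ¬ c < 1 + μ := by rw [hμ1]; exact h.not_gt
      have h2 : ¬ c < 1 + ζ := fun h' => h3 (h'.trans (by rwa [add_lt_add_iff_left]))
      simp only [hY, h2, h3, if_false]

theorem isSemidecidable_univ (a : S) :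
    IsSemidecidable a (Set.univ : Set (Word.{u} S)) := by
  refine ⟨eraseProgram a, fun w => ?_⟩
  obtain ⟨ξ, hξ⟩ := w.2
  rw [interp_eraseProgram a hξ]
  have : pseudoChar a (Set.univ : Set (Word.{u} S)) w = Part.some (singleWord a) :=
    Part.eq_some_iff.2 ⟨trivial, rfl⟩
  rw [this, Part.map_some]
  rfl

end Erase

/-! ### The program that enumerates the semidecided class. -/

section Enumeration

variable {S : Type v} [Fintype S] [LinearOrder (Option S)]

/-- The motion token with a given number. -/
def Motion.ofCode : ℕ → Motion
  | 1 => .left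
  | 2 => .stay
  | _ => .right

theorem Motion.ofCode_code (m : Motion) : Motion.ofCode m.code = m := by
  cases m <;> rfl

/-- The rule for simulating `p` by the states `ω * (b + δ) + j`. When `p` halts, the new state
is `e`. -/
noncomputable def simulationRule (p : Program.{u} S) (b e : Ordinal.{u}) (μ : Motion → Motion)
    (x : Ordinal.{u}) (j : ℕ) (s : Option S) : Ordinal.{u} × Option S × Motion :=
  open Classical in
  if j = 0 then
    if x = b + 1 then (e, s, .stay)
    else (ω * (b + (p.total (x - b, s)).1) + (p.total (x - b, s)).2.2.code,
      (p.total (x - b, s)).2.1, (p.total (x - b, s)).2.2)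
  else (ω * x, s, μ (Motion.ofCode j))

/-- The rule for returning the head to the cell `0`. -/
noncomputable def jumpRule (x : Ordinal.{u}) (j : ℕ) (s : Option S) :
    Ordinal.{u} × Option S × Motion :=
  (ω * x + (j + 1 : ℕ), s, .stay)

/-- The rule for copying the even cells into the odd cells. -/
noncomputable def copyRule (x : Ordinal.{u}) : ℕ → Option S → Ordinal.{u} × Option S × Motion
  | 0, none => (ω * (x + 1), none, .stay)
  | 0, some s => (ω * x + (symCode (some s) + 1 : ℕ), some s, .right)
  | n + 1, _ => (ω * x, symDecode n, .right)

/-- The rule of `enumProgram`. -/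
noncomputable def enumRule (q p : Program.{u} S) (b₁ b₂ b₃ : Ordinal.{u}) (x : Ordinal.{u})
    (j : ℕ) (s : Option S) : Ordinal.{u} × Option S × Motion :=
  open Classical in
  if x = 0 then (ω * 1, s, .stay)
  else if x < b₁ then simulationRule q 1 (ω * b₁) (fun _ => .stay) x j s
  else if x = b₁ then jumpRule x j s
  else if x = b₁ + 1 then copyRule x j s
  else if x = b₁ + 1 + 1 then jumpRule x j s
  else if x < b₃ then simulationRule p b₂ (ω * b₃) id x j s
  else if x = b₃ then jumpRule x j s
  else if x = b₃ + 1 then (ω * (b₃ + 1 + 1), none, .stay)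
  else if x < b₃ + 1 + 1 + ω then (ω * x + (passRule S j s).1, (passRule S j s).2)
  else (1, s, .stay)

/-- Given bounds `κ` and `κ'` for the states of `q` and `p`, this program runs `q`, copies the
contents `w` of the even cells of the output into the odd cells, runs `p` on the even cells, and
finally outputs `w` from the odd cells. -/
noncomputable def enumProgram (q p : Program.{u} S) (κ κ' : Ordinal.{u}) : Program.{u} S :=
  Program.ofRule (ω * (1 + κ + 1 + 1 + 1 + κ' + 1 + 1 + ω + 1)) fun o s =>
    enumRule q p (1 + κ) (1 + κ + 1 + 1 + 1) (1 + κ + 1 + 1 + 1 + κ') (o / ω) (finPart o) s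

theorem enumProgram_apply {S : Type v} [Fintype S] (q p : Program.{u} S) {κ κ' x : Ordinal.{u}}
    (hx : x ≤ 1 + κ + 1 + 1 + 1 + κ' + 1 + 1 + ω) (j : ℕ) (s : Option S) :
    (enumProgram q p κ κ').toFun (ω * x + j, s) = some (enumRule q p (1 + κ)
      (1 + κ + 1 + 1 + 1) (1 + κ + 1 + 1 + 1 + κ') x j s) := by
  rw [enumProgram, Program.ofRule_apply (omega_mul_add_lt (lt_add_one_iff.2 hx) j),
    omega_mul_add_div, finPart_omega_mul_add]

/-- `N` is the least ordinal with `ξ ≤ 2 * N`. The emptiness beyond `2 * N` lets the copying phase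
recognise the end of the word. -/
theorem isWord_even {S : Type v} {v : Tape.{u} S} {ξ : Ordinal.{u}} (hv : ∀ η, (v η).isSome ↔ η < ξ) :
    ∃ N, (∀ η, (v (2 * η)).isSome ↔ η < N) ∧ ∀ c, 2 * N ≤ c → v c = none := by
  have hne : {η | ξ ≤ 2 * η}.Nonempty :=
    ⟨ξ, (isNormal_mul_right (a := (2 : Ordinal.{u})) two_pos).strictMono.le_apply⟩
  refine ⟨sInf {η | ξ ≤ 2 * η}, fun η => ?_, fun c hc => ?_⟩
  · rw [hv, ← not_le, ← not_le]
    refine not_congr ⟨fun h => csInf_le' h, fun h => (csInf_mem hne).trans ?_⟩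
    gcongr
  · have : ¬ c < ξ := ((csInf_mem hne).trans hc).not_gt
    simpa using (not_congr (hv c)).2 this

/-- There is a program that computes the word in the even cells of the output of `q`, if `p` halts on
that word. -/
theorem exists_program_even_of_halts (q p : Program.{u} S) (a : S) : ∃ r : Program.{u} S, ∀ x : Tape.{u} S,
    (interp q x = Part.none → interp r x = Part.none) ∧
    ∀ v ∈ interp q x, ∀ w : Tape.{u} S, (∀ η, v (2 * η) = w η) →
      (∃ ξ, ∀ η, (v η).isSome ↔ η < ξ) →
      (interp p w = Part.none → interp r x = Part.none) ∧
      (interp p w = Part.some (ordTape a 0) → interp r x = Part.some w) := by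
  classical
  obtain ⟨κ, hκ⟩ := exists_state_lt q
  obtain ⟨κ', hκ'⟩ := exists_state_lt p
  refine ⟨enumProgram q p κ κ', fun x => ?_⟩
  set r := enumProgram q p κ κ' with hr_def
  have happ := fun (x : Ordinal.{u}) hx j s => enumProgram_apply q p (κ := κ) (κ' := κ') (x := x)
    hx j s
  rw [← hr_def] at happ
  set b₁ : Ordinal.{u} := 1 + κ with hb₁
  set b₂ : Ordinal.{u} := b₁ + 1 + 1 + 1 with hb₂
  set b₃ : Ordinal.{u} := b₂ + κ' with hb₃
  have l1 : 1 ≤ b₁ := le_self_add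
  have l12 : b₁ < b₁ + 1 := lt_add_one _
  have l13 : b₁ + 1 < b₁ + 1 + 1 := lt_add_one _
  have l14 : b₁ + 1 + 1 < b₂ := lt_add_one _
  have l23 : b₂ ≤ b₃ := le_self_add
  have l34 : b₃ < b₃ + 1 := lt_add_one _
  have l35 : b₃ + 1 < b₃ + 1 + 1 := lt_add_one _
  have lω : b₃ + 1 + 1 ≤ b₃ + 1 + 1 + ω := le_self_add
  have R0 : ∀ s, r.toFun (0, s) = some (ω * 1, s, .stay) := fun s => by
    have := happ 0 zero_le 0 s
    rw [enumRule, if_pos rfl] at this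
    simpa using this
  have Rq : ∀ x, 1 ≤ x → x < b₁ → ∀ (j : ℕ) s, r.toFun (ω * x + j, s) =
      some (simulationRule q 1 (ω * b₁) (fun _ => .stay) x j s) := fun x h1 h2 j s => by
    rw [happ x (by order), enumRule, if_neg (zero_lt_one.trans_le h1).ne', if_pos h2]
  have Rj1 : ∀ (j : ℕ) s, r.toFun (ω * b₁ + j, s) = some (jumpRule b₁ j s) := fun j s => by
    rw [happ _ (by order), enumRule, if_neg (zero_lt_one.trans_le l1).ne', if_neg (lt_irrefl _),
      if_pos rfl]
  have Rc : ∀ (j : ℕ) s, r.toFun (ω * (b₁ + 1) + j, s) = some (copyRule (b₁ + 1) j s) :=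
    fun j s => by
      rw [happ _ (by order), enumRule, if_neg (zero_lt_one.trans_le (l1.trans l12.le)).ne',
        if_neg (by order), if_neg (by order), if_pos rfl]
  have Rj2 : ∀ (j : ℕ) s, r.toFun (ω * (b₁ + 1 + 1) + j, s) =
      some (jumpRule (b₁ + 1 + 1) j s) := fun j s => by
    rw [happ _ (by order), enumRule,
      if_neg (zero_lt_one.trans_le (l1.trans (l12.trans l13).le)).ne',
      if_neg (by order), if_neg (by order), if_neg (by order), if_pos rfl]
  have Rp : ∀ x, b₂ ≤ x → x < b₃ → ∀ (j : ℕ) s, r.toFun (ω * x + j, s) =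
      some (simulationRule p b₂ (ω * b₃) id x j s) := fun x h1 h2 j s => by
    have h0 : 0 < x := zero_lt_one.trans_le (by order)
    rw [happ x (by order), enumRule, if_neg h0.ne', if_neg (by order), if_neg (by order),
      if_neg (by order), if_neg (by order), if_pos h2]
  have Rj3 : ∀ (j : ℕ) s, r.toFun (ω * b₃ + j, s) = some (jumpRule b₃ j s) := fun j s => by
    have h0 : 0 < b₃ := zero_lt_one.trans_le (by order)
    rw [happ _ (by order), enumRule, if_neg h0.ne', if_neg (by order), if_neg (by order),
      if_neg (by order), if_neg (by order), if_neg (by order), if_pos rfl]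
  have Re : ∀ s, r.toFun (ω * (b₃ + 1), s) = some (ω * (b₃ + 1 + 1), none, .stay) := fun s => by
    have h0 : 0 < b₃ + 1 := zero_lt_one.trans_le (by order)
    have := happ (b₃ + 1) (by order) 0 s
    rw [enumRule, if_neg h0.ne', if_neg (by order), if_neg (by order),
      if_neg (by order), if_neg (by order), if_neg (by order), if_neg (by order), if_pos rfl]
      at this
    simpa using this
  have Rk : ∀ (k j : ℕ) s, r.toFun (ω * (b₃ + 1 + 1 + k) + j, s) =
      some (ω * (b₃ + 1 + 1 + k) + (passRule S j s).1, (passRule S j s).2) := fun k j s => by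
    have h1 : b₃ + 1 + 1 ≤ b₃ + 1 + 1 + k := le_self_add
    have h2 : b₃ + 1 + 1 + k < b₃ + 1 + 1 + ω := by
      rw [add_lt_add_iff_left]; exact natCast_lt_omega0 k
    have h0 : 0 < b₃ + 1 + 1 + (k : Ordinal) := zero_lt_one.trans_le (by order)
    rw [happ _ h2.le, enumRule, if_neg h0.ne', if_neg (by order), if_neg (by order),
      if_neg (by order), if_neg (by order), if_neg (by order), if_neg (by order),
      if_neg (by order), if_pos h2]
  have Rh : ∀ s, r.toFun (ω * (b₃ + 1 + 1 + ω), s) = some (1, s, .stay) := fun s => by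
    have h0 : 0 < b₃ + 1 + 1 + ω := zero_lt_one.trans_le (by order)
    have := happ (b₃ + 1 + 1 + ω) le_rfl 0 s
    rw [enumRule, if_neg h0.ne', if_neg (by order), if_neg (by order),
      if_neg (by order), if_neg (by order), if_neg (by order), if_neg (by order),
      if_neg (by order), if_neg (by order)] at this
    simpa using this
  clear_value r
  have q1 : ∀ δ < κ, δ ≠ 1 → ∀ s, r.toFun (ω * (1 + δ), s) =
      some (ω * (1 + (q.total (δ, s)).1) + (q.total (δ, s)).2.2.code, (q.total (δ, s)).2.1,
        (q.total (δ, s)).2.2) := fun δ hδ hδ1 s => by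
    have := Rq (1 + δ) le_self_add (by rw [hb₁]; gcongr) 0 s
    rw [simulationRule, if_pos rfl, if_neg (by simpa using hδ1), add_sub_cancel] at this
    simpa using this
  have q2 : ∀ δ < κ, ∀ m : Motion, ∀ s, r.toFun (ω * (1 + δ) + m.code, s) =
      some (ω * (1 + δ), s, .stay) := fun δ hδ m s => by
    rw [Rq (1 + δ) le_self_add (by rw [hb₁]; gcongr), simulationRule, if_neg m.code_ne_zero]
  have p1 : ∀ δ < κ', δ ≠ 1 → ∀ s, r.toFun (ω * (b₂ + δ), s) =
      some (ω * (b₂ + (p.total (δ, s)).1) + (p.total (δ, s)).2.2.code, (p.total (δ, s)).2.1,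
        (p.total (δ, s)).2.2) := fun δ hδ hδ1 s => by
    have := Rp (b₂ + δ) le_self_add (by rw [hb₃]; gcongr) 0 s
    rw [simulationRule, if_pos rfl, if_neg (by simpa using hδ1), add_sub_cancel] at this
    simpa using this
  have p2 : ∀ δ < κ', ∀ m : Motion, ∀ s, r.toFun (ω * (b₂ + δ) + m.code, s) =
      some (ω * (b₂ + δ), s, id m) := fun δ hδ m s => by
    rw [Rp (b₂ + δ) le_self_add (by rw [hb₃]; gcongr), simulationRule, if_neg m.code_ne_zero,
      Motion.ofCode_code]
  have hid : TapeEmbedding (S := S) (fun Y => Y) (fun η : Ordinal.{u} => η) :=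
    ⟨fun _ _ => rfl, fun c => Or.inl ⟨c, rfl⟩⟩
  have hg : IsNormal fun η : Ordinal.{u} => 2 * η := isNormal_mul_right two_pos
  have c0 : computation r ⟨x, 0, 0⟩ 0 = ⟨x, 0, 0⟩ := computation_zero _ _
  have c1 : computation r ⟨x, 0, 0⟩ 1 = ⟨x, ω * (1 + 0), 0⟩ := by
    rw [← zero_add (1 : Ordinal.{u}), computation_add_one, c0, step_keep rfl (R0 _), move_stay]
    simp
  have r1 : RunsBelow r ⟨x, 0, 0⟩ 1 (ω * 1) := by
    intro t ht
    rw [lt_one_iff] at ht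
    subst ht
    rw [c0]
    exact ⟨by simp, zero_ne_one⟩
  refine ⟨fun hq => interp_eq_none (computation_simulate_ne_one (p := q) (x₀ := ⟨x, 0, 0⟩)
    (μ := fun _ => .stay) le_rfl (hκ x) IsNormal.id rfl hid (fun _ _ => rfl) q1 q2 c1 r1
    (state_ne_one_of_interp_eq_none hq)), fun v hv w hvw ⟨ξ, hξ⟩ => ?_⟩
  obtain ⟨γ, hγ1, rfl, hγ⟩ := exists_halt_of_mem hv
  obtain ⟨c2, r2⟩ := computation_simulate (p := q) (x₀ := ⟨x, 0, 0⟩)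
    (μ := fun _ => .stay) le_rfl (hκ x) IsNormal.id rfl hid (fun _ _ => rfl) q1 q2 c1 r1 hγ
  have h1κ : 1 < κ := hγ1 ▸ hκ x γ
  rw [hγ1] at c2
  set v := (computation q ⟨x, 0, 0⟩ γ).tape
  obtain ⟨N, hN, hvN⟩ := isWord_even hξ
  have hwN : ∀ η, (w η).isSome ↔ η < N := fun η => by rw [← hvw, hN]
  have qexit : ∀ s, r.toFun (ω * (1 + 1), s) = some (ω * b₁, s, .stay) := fun s => by
    have := Rq (1 + 1) le_self_add (by rw [hb₁]; gcongr) 0 s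
    rw [simulationRule, if_pos rfl, if_pos rfl] at this
    simpa using this
  have c3 := (computation_add_one r ⟨x, 0, 0⟩ _).trans
    ((congrArg _ c2).trans (step_keep rfl (qexit _)))
  have r3 := r2.add_one (by rw [c2]; exact omega_mul_lt (by gcongr))
    (by rw [c2]; exact (one_lt_omega_mul le_self_add).ne')
  -- The head position at which `q` halts is unknown, so it has to be reset before copying; likewise
  -- after copying and after the simulation of `p`.
  obtain ⟨c4, r4, -⟩ := computation_jump (j₀ := 0) l1 (fun j _ s => Rj1 j s) (by simpa using c3)
    (r3.mono (omega_mul_le l12.le))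
  obtain ⟨T₅, h₅, c5, r5⟩ := computation_copy (l1.trans l12.le)
    (fun s => by simpa [copyRule] using Rc 0 (some s))
    (fun n s => by simpa only [copyRule] using Rc (n + 1) s)
    (by simpa [copyRule] using Rc 0 none) hvw hwN hvN c4 r4
  obtain ⟨c6, r6, -⟩ := computation_jump (j₀ := 0) (l1.trans (l12.trans l13).le)
    (fun j _ s => Rj2 j s) (by simpa using c5) (r5.mono (omega_mul_le l14.le))
  -- This is the initial snapshot of `p` on `w`, embedded in the even cells while the odd cells
  -- preserve `w`.
  have c6' : computation r ⟨x, 0, 0⟩ (T₅ + ω) = ⟨interleave w w, ω * (b₂ + 0), 2 * 0⟩ := by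
    rw [c6, add_zero, mul_zero]
  have lb2 : 1 ≤ b₂ := by order
  refine ⟨fun hp => interp_eq_none (computation_simulate_ne_one (p := p) (x₀ := ⟨w, 0, 0⟩)
    (E := fun Y => interleave Y w) (g := fun η => 2 * η) (μ := id) lb2 (hκ' w) hg (mul_zero 2)
    (tapeEmbedding_interleave w) move_move_two_mul p1 p2 c6' r6
    (state_ne_one_of_interp_eq_none hp)), fun hp => ?_⟩
  obtain ⟨γ', hγ1', hout, hγ'⟩ := exists_halt_of_mem (Part.eq_some_iff.1 hp)
  obtain ⟨c7, r7⟩ := computation_simulate (p := p) (x₀ := ⟨w, 0, 0⟩)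
    (E := fun Y => interleave Y w) (g := fun η => 2 * η) (μ := id) lb2 (hκ' w) hg (mul_zero 2)
    (tapeEmbedding_interleave w) move_move_two_mul p1 p2 c6' r6 hγ'
  have h1κ' : 1 < κ' := hγ1' ▸ hκ' w γ'
  rw [hγ1', hout] at c7
  have pexit : ∀ s, r.toFun (ω * (b₂ + 1), s) = some (ω * b₃, s, .stay) := fun s => by
    have := Rp (b₂ + 1) le_self_add (by rw [hb₃]; gcongr) 0 s
    rw [simulationRule, if_pos rfl, if_pos rfl] at this
    simpa using this
  have c8 := (computation_add_one r ⟨x, 0, 0⟩ _).trans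
    ((congrArg _ c7).trans (step_keep rfl (pexit _)))
  have r8 := r7.add_one (by rw [c7]; exact omega_mul_lt (by gcongr))
    (by rw [c7]; exact (one_lt_omega_mul (lb2.trans le_self_add)).ne')
  obtain ⟨c9, r9, -⟩ := computation_jump (j₀ := 0) (lb2.trans l23) (fun j _ s => Rj3 j s)
    (by simpa using c8) (r8.mono (omega_mul_le l34.le))
  -- The output of `p` occupies only cell 0 of its track. Erasing that cell leaves `w` in the odd
  -- cells, which is where the compression starts.
  have hclean : Function.update (interleave (ordTape a 0) w) 0 none = layout 0 w := by
    rw [layout_zero]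
    refine eq_interleave (fun η => ?_) fun η => ?_
    · by_cases h : η = 0
      · simp [h]
      · rw [Function.update_of_ne (by simpa using h), interleave_even]
        simp [ordTape, h]
    · rw [Function.update_of_ne (by simp), interleave_odd]
  have c10 := (computation_add_one r ⟨x, 0, 0⟩ _).trans
    ((congrArg _ c9).trans (step_write rfl (Re _)))
  rw [hclean, move_stay] at c10
  have r10 := (r9.mono (omega_mul_le l35.le)).add_one (by rw [c9]; exact omega_mul_lt l35)
    (by rw [c9]; exact (one_lt_omega_mul (by order)).ne')
  obtain ⟨T₁₁, c11, r11⟩ := computation_compress (by order) Rk hwN c10 r10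
  have c12 := (computation_add_one r ⟨x, 0, 0⟩ _).trans
    ((congrArg _ c11).trans (step_keep rfl (Rh _)))
  have r12 := (r11.mono (omega_mul_le (lt_add_one _).le)).add_one
    (by rw [c11]; exact omega_mul_lt (lt_add_one _))
    (by rw [c11]; exact (one_lt_omega_mul (by order)).ne')
  rw [interp_eq_some c12 rfl r12]

end Enumeration

end SymMachine

/-! ### The equivalence. -/

theorem proposition6p4 {S : Type v} [Fintype S] [LinearOrder (Option S)]
    (zero one : S) (hne : zero ≠ one) :
    SymMachine.SymmetryCondition.{u, v} S zero ↔
      ∀ A : Set (SymMachine.Word.{u, v} S), A.Nonempty →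
        SymMachine.IsSemidecidable zero A → SymMachine.IsCE zero A := by
  constructor
  · rintro ⟨q, hq⟩ A - ⟨p, hp⟩
    obtain ⟨r, hr⟩ := SymMachine.exists_program_even_of_halts q p zero
    have hpA : ∀ w : SymMachine.Word.{u, v} S, w ∈ A →
        SymMachine.interp p w.1 = Part.some (SymMachine.ordTape zero 0) := fun w hw => by
      rw [← hp w, Part.eq_some_iff]
      exact ⟨hw, rfl⟩
    have hpA' : ∀ w : SymMachine.Word.{u, v} S, w ∉ A →
        SymMachine.interp p w.1 = Part.none := fun w hw => by
      rw [← hp w, Part.eq_none_iff']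
      exact hw
    refine ⟨r, Set.ext fun y => ⟨?_, ?_⟩⟩
    · rintro ⟨w, hw, rfl⟩
      obtain ⟨N, hN⟩ := w.2
      -- The word that repeats each entry of `w` twice is among the outputs of `q`, and its even
      -- part is `w`.
      have hv : ∀ c, (w.1 (c / 2)).isSome ↔ c < 2 * N := fun c => by
        rw [hN, Ordinal.lt_mul_iff_div_lt two_ne_zero]
      have hmem : (fun c => w.1 (c / 2)) ∈
          Subtype.val '' (Set.univ : Set (SymMachine.Word.{u, v} S)) :=
        ⟨⟨_, 2 * N, hv⟩, trivial, rfl⟩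
      rw [hq] at hmem
      obtain ⟨α, hα⟩ := hmem
      refine ⟨α, ?_⟩
      rw [((hr _).2 _ hα w.1 (fun η => by rw [SymMachine.two_mul_div_two]) ⟨_, hv⟩).2 (hpA w hw)]
      exact Part.mem_some _
    · rintro ⟨α, hα⟩
      -- Conversely, an output of `r` forces `q` to produce a word and `p` to halt on its even part,
      -- which therefore lies in `A` and is the output.
      rcases Part.eq_none_or_eq_some (SymMachine.interp q (SymMachine.ordTape zero α)) with
        h | ⟨v, h⟩
      · rw [(hr _).1 h] at hα
        exact absurd hα (Part.notMem_none _)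
      · have hv : v ∈ SymMachine.interp q (SymMachine.ordTape zero α) := Part.eq_some_iff.1 h
        have hmem : v ∈ {y | ∃ α, y ∈ SymMachine.interp q (SymMachine.ordTape zero α)} := ⟨α, hv⟩
        rw [← hq] at hmem
        obtain ⟨⟨_, ξ, hξ⟩, -, rfl⟩ := hmem
        obtain ⟨N, hN, -⟩ := SymMachine.isWord_even hξ
        obtain ⟨h1, h2⟩ := (hr _).2 _ hv _ (fun _ => rfl) ⟨ξ, hξ⟩
        by_cases hA : (⟨_, N, hN⟩ : SymMachine.Word.{u, v} S) ∈ A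
        · rw [h2 (hpA _ hA)] at hα
          exact ⟨_, hA, (Part.mem_some_iff.1 hα).symm⟩
        · rw [h1 (hpA' _ hA)] at hα
          exact absurd hα (Part.notMem_none _)
  · exact fun h => h Set.univ ⟨SymMachine.singleWord zero, trivial⟩
      (SymMachine.isSemidecidable_univ zero)
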